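/- For $a,b,c,d\in\mathbb{C}$ let $$|\Psi\rangle=\tfrac{a+d}{2}(|0000\rangle+|1111\rangle)+\tfrac{a-d}{2}(|0011\rangle+|1100\rangle)+\tfrac{b+c}{2}(|0101\rangle+|1010\rangle)+\tfrac{b-c}{2}(|0110\rangle+|1001\rangle).$$ Call the parameters generic if $a^2,b^2,c^2,d^2$ are pairwise distinct and no $q\in\mathbb{C}$ with $q\neq 1$ satisfies $\{qa^2,qb^2,qc^2,qd^2\}=\{a^2,b^2,c^2,d^2\}$. A generic 4-qubit state is a state $g|\Psi\rangle$ with generic parameters and $g=g^1\otimes g^2\otimes g^3\otimes g^4$, $g^i\in GL(2,\mathbb{C})$. States are considered up to normalization and global phase, and LOCC means deterministic transformations by LOCC protocols with finitely many rounds. A state is fully entangled if it is not a product across any bipartition of the four parties. (1) A generic 4-qubit state $g|\Psi\rangle$ can be converted by LOCC into some fully entangled 4-qubit state that is not LU-equivalent to it if and only if, up to a permutation of the parties and up to local unitaries (multiplying the $g^i$ from the left), $g=g^1\otimes g_w^2\otimes g_w^3\otimes g_w^4$ for some $w\in\{x,y,z\}$, where $g^1$ is arbitrary and $g_w^i\in\mathrm{span}\{\mathbb{1},W\}$,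 with $W\in\{X,Y,Z\}$ the Pauli matrix belonging to $w$. (2) Every generic 4-qubit state $g|\Psi\rangle$ for which $g$ is not of this form is isolated: it can neither be obtained by LOCC from, nor be converted by LOCC into, any fully entangled 4-qubit state that is not LU-equivalent to it. (3) Almost all generic 4-qubit states are isolated: the set of generic 4-qubit states that are not isolated has Lebesgue measure zero in $\mathbb{C}^{16}$. -/

import Mathlib

open MeasureTheory

/-- Pure states (unnormalised vectors) of four parties, where party `i` holds a system of
dimension `d i`. -/
abbrev StateSpace (d : Fin 4 → ℕ) : Type := (∀ i, Fin (d i)) → ℂ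

/-- Pure states (unnormalised vectors) of four qubits, written in the computational basis. -/
abbrev FourQubit : Type := (Fin 4 → Fin 2) → ℂ

/-- The action of the product operator `A 0 ⊗ A 1 ⊗ A 2 ⊗ A 3` on a vector. -/
noncomputable def localApply {d e : Fin 4 → ℕ} (A : ∀ i, Matrix (Fin (e i)) (Fin (d i)) ℂ)
    (ψ : StateSpace d) : StateSpace e :=
  fun x => ∑ y : (∀ i, Fin (d i)), (∏ i, A i (x i) (y i)) * ψ y

/-- `LOCCTo φ ψ`: some LOCC protocol (finitely many rounds, arbitrary local dimensions in the
intermediate steps) transforms `ψ` deterministically into the four-qubit state `φ`.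

* `done`: the protocol may stop once the current (subnormalised) vector is a multiple of `φ`.
  The multiple `0` is a branch that occurs with probability zero.
* `round`: party `k` performs a local measurement with finitely many outcomes `j` and Kraus
  operators `K j k`, and announces the outcome; every other party `i` then applies a local
  isometry `K j i` that may depend on the outcome. The protocol goes on in a way that may depend
  on the outcome as well, and has to lead to `φ` for each of the outcomes. -/
inductive LOCCTo (φ : FourQubit) : ∀ {d : Fin 4 → ℕ}, StateSpace d → Prop
  | done (c : ℂ) (ψ : StateSpace (fun _ => 2)) (h : ψ = c • φ) : LOCCTo φ ψ
  | round {d : Fin 4 → ℕ} (ψ : StateSpace d) (k : Fin 4) (m : ℕ) (e : Fin m → Fin 4 → ℕ)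
      (K : ∀ (j : Fin m) (i : Fin 4), Matrix (Fin (e j i)) (Fin (d i)) ℂ)
      (complete : ∑ j, (K j k).conjTranspose * K j k = 1)
      (isometry : ∀ j i, i ≠ k → (K j i).conjTranspose * K j i = 1)
      (next : ∀ j, LOCCTo φ (localApply (K j) ψ)) : LOCCTo φ ψ

/-- The four-qubit state `ψ` can be converted deterministically by LOCC into `φ`. -/
def LOCCConvertible (ψ φ : FourQubit) : Prop :=
  LOCCTo φ (d := fun _ => 2) ψ

/-- Equivalence under local unitaries, up to normalisation and global phase. -/
def LUEquivalent (ψ φ : FourQubit) : Prop :=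
  ∃ (U : Fin 4 → Matrix.unitaryGroup (Fin 2) ℂ) (c : ℂ), c ≠ 0 ∧
    φ = c • localApply (d := fun _ => 2) (e := fun _ => 2)
      (fun i => (U i : Matrix (Fin 2) (Fin 2) ℂ)) ψ

/-- A state is fully entangled if it is not a product across any bipartition of the parties. -/
def FullyEntangled (ψ : FourQubit) : Prop :=
  ∀ S : Finset (Fin 4), S ≠ ∅ → S ≠ Finset.univ →
    ¬ ∃ (u : ({i // i ∈ S} → Fin 2) → ℂ) (v : ({i // i ∉ S} → Fin 2) → ℂ),
      ∀ x : Fin 4 → Fin 2, ψ x = u (fun i => x i) * v (fun i => x i)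

/-- `ψ` is isolated: it can neither be obtained by LOCC from, nor be converted by LOCC into,
a fully entangled state that is not LU-equivalent to it. -/
def Isolated (ψ : FourQubit) : Prop :=
  ∀ φ : FourQubit, FullyEntangled φ → ¬ LUEquivalent ψ φ →
    ¬ LOCCConvertible φ ψ ∧ ¬ LOCCConvertible ψ φ

/-- The seed state with parameters `(a, b, c, d) = (p 0, p 1, p 2, p 3)`. -/
noncomputable def seed (p : Fin 4 → ℂ) : FourQubit := fun x =>
  if x = ![0, 0, 0, 0] ∨ x = ![1, 1, 1, 1] then (p 0 + p 3) / 2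
  else if x = ![0, 0, 1, 1] ∨ x = ![1, 1, 0, 0] then (p 0 - p 3) / 2
  else if x = ![0, 1, 0, 1] ∨ x = ![1, 0, 1, 0] then (p 1 + p 2) / 2
  else if x = ![0, 1, 1, 0] ∨ x = ![1, 0, 0, 1] then (p 1 - p 2) / 2
  else 0

/-- Generic seed parameters: `a ≠ ±b` and so on, and the set `{a², b², c², d²}` is not mapped to
itself by the multiplication with any number other than `1`. -/
def GenericSeed (p : Fin 4 → ℂ) : Prop :=
  (Function.Injective fun i => p i ^ 2) ∧
    ∀ q : ℂ, (Set.range fun i => q * p i ^ 2) = (Set.range fun i => p i ^ 2) → q = 1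

/-- The state `(g 0 ⊗ g 1 ⊗ g 2 ⊗ g 3) |Ψ⟩`, where `|Ψ⟩` is the seed state with parameters `p`. -/
noncomputable def genericState (p : Fin 4 → ℂ) (g : Fin 4 → GL (Fin 2) ℂ) : FourQubit :=
  localApply (d := fun _ => 2) (e := fun _ => 2)
    (fun i => (g i : Matrix (Fin 2) (Fin 2) ℂ)) (seed p)

/-- The generic four-qubit states. -/
def IsGeneric (ψ : FourQubit) : Prop :=
  ∃ (p : Fin 4 → ℂ) (g : Fin 4 → GL (Fin 2) ℂ), GenericSeed p ∧ ψ = genericState p g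

/-- The Pauli matrices `X`, `Y`, `Z`. -/
noncomputable def pauli : Fin 3 → Matrix (Fin 2) (Fin 2) ℂ :=
  ![!![0, 1; 1, 0], !![0, -Complex.I; Complex.I, 0], !![1, 0; 0, -1]]

/-- Up to a unitary on the left (a local unitary on the state), the one-qubit operator `A` is of
the form `g_w`, that is, lies in the span of the identity and of the Pauli matrix `w`. -/
def AlongAxis (w : Fin 3) (A : Matrix (Fin 2) (Fin 2) ℂ) : Prop :=
  ∃ U ∈ Matrix.unitaryGroup (Fin 2) ℂ, ∃ B ∈ Submodule.span ℂ {1, pauli w}, A = U * B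

/-- Up to a permutation of the parties and up to local unitaries,
`g = g¹ ⊗ g_w² ⊗ g_w³ ⊗ g_w⁴` for some `w`, with `g¹` arbitrary. The party `k` is the one that
holds the arbitrary operator. -/
def HasAxisForm (g : Fin 4 → GL (Fin 2) ℂ) : Prop :=
  ∃ (k : Fin 4) (w : Fin 3), ∀ i, i ≠ k → AlongAxis w (g i : Matrix (Fin 2) (Fin 2) ℂ)

/-! Every branch of a protocol acts on the state as a product operator. If source and target are
fully entangled, each contributing branch has invertible factors (`LOCCTo.exists_kraus`), so both
states have the form g|Ψ⟩ and h|Ψ⟩ with the same seed. If A is the product operator that a branch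
applies to the seed, then h⁻¹A fixes the seed up to a factor. For generic parameters the only such
symmetries are σ⊗σ⊗σ⊗σ with σ the identity or a Pauli matrix, up to scalars
(`GenericSeed.stabilizer`). Completeness of the measurement therefore says that the Gram operator
⊗gᵢ†gᵢ is a nonnegative mixture of the four Pauli conjugates of ⊗hᵢ†hᵢ
(`LOCCConvertible.exists_pauli_mixture`).

In the Pauli basis, conjugation only changes signs. Each Bloch component is thus multiplied by a
mean sign, and a product of components at different parties by the mean of the product of their
signs. Comparing the two (`pauliConj_or_axis`) leaves two cases: the mixture acts like a single
Pauli conjugation, and the states are LU-equivalent, or in both states all parties but one have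
Bloch vectors along a common axis, which is the axis form.

Conversely, in the axis form the exceptional party k can write gₖ†gₖ as a mixture of h†h and σh†hσ
with h of different purity. It measures accordingly, and after the second outcome the other parties
supply the missing σ by local unitaries (`exists_conversion_of_hasAxisForm`).

States of the axis form lie in the images of twelve C¹ maps from a real space of dimension 31 into
one of dimension 32, so they form a null set. -/

/-! ### Product operators and their action on vectors. -/

section Kronecker

/-- The Kronecker product of the matrices `A i`. -/
def piKron {d e : Fin 4 → ℕ} (A : ∀ i, Matrix (Fin (e i)) (Fin (d i)) ℂ) :
    Matrix (∀ i, Fin (e i)) (∀ i, Fin (d i)) ℂ :=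
  Matrix.of fun x y => ∏ i, A i (x i) (y i)

variable {d e f : Fin 4 → ℕ}

theorem piKron_mul (A : ∀ i, Matrix (Fin (f i)) (Fin (e i)) ℂ)
    (B : ∀ i, Matrix (Fin (e i)) (Fin (d i)) ℂ) :
    piKron (fun i => A i * B i) = piKron A * piKron B := by
  ext x y
  simp only [piKron, Matrix.of_apply, Matrix.mul_apply, Finset.prod_univ_sum,
    Fintype.piFinset_univ, Finset.prod_mul_distrib]

theorem piKron_one : piKron (fun i => (1 : Matrix (Fin (d i)) (Fin (d i)) ℂ)) = 1 := by
  ext x y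
  simp only [piKron, Matrix.of_apply, Matrix.one_apply, Finset.prod_ite_zero,
    Finset.prod_const_one, Finset.mem_univ, true_imp_iff, funext_iff]

theorem piKron_smul (c : Fin 4 → ℂ) (A : ∀ i, Matrix (Fin (e i)) (Fin (d i)) ℂ) :
    piKron (fun i => c i • A i) = (∏ i, c i) • piKron A := by
  ext x y
  simp [piKron, Finset.prod_mul_distrib]

theorem trace_piKron (A : ∀ i, Matrix (Fin (d i)) (Fin (d i)) ℂ) :
    (piKron A).trace = ∏ i, (A i).trace := by
  simp only [Matrix.trace, Matrix.diag, piKron, Matrix.of_apply, Finset.prod_univ_sum,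
    Fintype.piFinset_univ]

/-- The Kronecker product is linear in slot `k`. This turns the completeness relation of the one
measuring party into a relation for product operators. -/
theorem sum_piKron {ι : Type*} [Fintype ι] (k : Fin 4)
    (M : ι → ∀ i, Matrix (Fin (e i)) (Fin (d i)) ℂ) (N : ∀ i, Matrix (Fin (e i)) (Fin (d i)) ℂ)
    (h : ∀ j i, i ≠ k → M j i = N i) (hk : ∑ j, M j k = N k) :
    ∑ j, piKron (M j) = piKron N := by
  ext x y
  simp only [piKron, Matrix.sum_apply, Matrix.of_apply]
  rw [← Finset.mul_prod_erase _ _ (Finset.mem_univ k), ← hk, Matrix.sum_apply, Finset.sum_mul]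
  refine Finset.sum_congr rfl fun j _ => ?_
  rw [← Finset.mul_prod_erase _ _ (Finset.mem_univ k)]
  congr 1
  refine Finset.prod_congr rfl fun i hi => ?_
  rw [h j i (Finset.ne_of_mem_erase hi)]

theorem localApply_eq (A : ∀ i, Matrix (Fin (e i)) (Fin (d i)) ℂ) (ψ : StateSpace d) :
    localApply A ψ = (piKron A).mulVec ψ := rfl

theorem localApply_localApply (A : ∀ i, Matrix (Fin (f i)) (Fin (e i)) ℂ)
    (B : ∀ i, Matrix (Fin (e i)) (Fin (d i)) ℂ) (ψ : StateSpace d) :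
    localApply A (localApply B ψ) = localApply (fun i => A i * B i) ψ := by
  simp only [localApply_eq, piKron_mul, Matrix.mulVec_mulVec]

theorem localApply_one (ψ : StateSpace d) :
    localApply (fun i => (1 : Matrix (Fin (d i)) (Fin (d i)) ℂ)) ψ = ψ := by
  rw [localApply_eq, piKron_one, Matrix.one_mulVec]

theorem localApply_smul (c : Fin 4 → ℂ) (A : ∀ i, Matrix (Fin (e i)) (Fin (d i)) ℂ)
    (ψ : StateSpace d) :
    localApply (fun i => c i • A i) ψ = (∏ i, c i) • localApply A ψ := by
  rw [localApply_eq, piKron_smul, Matrix.smul_mulVec, localApply_eq]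

theorem localApply_smul_right (A : ∀ i, Matrix (Fin (e i)) (Fin (d i)) ℂ) (c : ℂ)
    (ψ : StateSpace d) : localApply A (c • ψ) = c • localApply A ψ := by
  rw [localApply_eq, Matrix.mulVec_smul, localApply_eq]

theorem localApply_zero (A : ∀ i, Matrix (Fin (e i)) (Fin (d i)) ℂ) :
    localApply A (0 : StateSpace d) = 0 := by
  rw [localApply_eq, Matrix.mulVec_zero]

theorem localApply_eq_of_left_inverse {A : ∀ i, Matrix (Fin (d i)) (Fin (e i)) ℂ}
    {B : ∀ i, Matrix (Fin (e i)) (Fin (d i)) ℂ} (h : ∀ i, A i * B i = 1) (ψ : StateSpace d) :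
    localApply A (localApply B ψ) = ψ := by
  rw [localApply_localApply]
  simp only [h, localApply_one]

theorem localApply_single {A : ∀ i, Matrix (Fin (d i)) (Fin (d i)) ℂ} {k : Fin 4}
    (h : ∀ i, i ≠ k → A i = 1) (ψ : StateSpace d) (x : ∀ i, Fin (d i)) :
    localApply A ψ x = ∑ b, A k (x k) b * ψ (Function.update x k b) := by
  refine (Fintype.sum_of_injective (fun b => Function.update x k b)
    (Function.update_injective x k) _ _ ?_ ?_).symm
  · intro y hy
    obtain ⟨i, hi, hxy⟩ : ∃ i, i ≠ k ∧ x i ≠ y i := by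
      by_contra! hc
      refine hy ⟨y k, funext fun i => ?_⟩
      by_cases hi : i = k
      · subst hi; simp
      · simp [hi, hc i hi]
    rw [Finset.prod_eq_zero (Finset.mem_univ i) (by rw [h i hi, Matrix.one_apply_ne hxy]), zero_mul]
  · intro b
    rw [Finset.prod_eq_single k]
    · simp
    · intro i _ hi
      simp [h i hi, hi]
    · simp

end Kronecker

/-! ### Full entanglement and invertibility of local operators. -/

section Entanglement

theorem FullyEntangled.ne_zero {ψ : FourQubit} (h : FullyEntangled ψ) : ψ ≠ 0 := by
  rintro rfl
  exact h {0} (by decide) (by decide) ⟨0, 0, by simp⟩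

theorem FullyEntangled.smul {ψ : FourQubit} (h : FullyEntangled ψ) {c : ℂ} (hc : c ≠ 0) :
    FullyEntangled (c • ψ) := by
  rintro S h1 h2 ⟨u, v, huv⟩
  refine h S h1 h2 ⟨c⁻¹ • u, v, fun x => ?_⟩
  have := huv x
  simp only [Pi.smul_apply, smul_eq_mul] at this ⊢
  rw [mul_assoc, ← this, inv_mul_cancel_left₀ hc]

/-- The two slices of a fully entangled state along a party are linearly independent. -/
theorem FullyEntangled.eq_zero_of_slice {ψ : FourQubit} (h : FullyEntangled ψ) (k : Fin 4)
    (r : Fin 2 → ℂ) (hr : ∀ x, ∑ b, r b * ψ (Function.update x k b) = 0) : r = 0 := by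
  by_contra hr0
  obtain ⟨a, ha⟩ : ∃ a, r a ≠ 0 := by
    by_contra! hc
    exact hr0 (funext hc)
  obtain ⟨a', haa', huniv⟩ : ∃ a' : Fin 2, a' ≠ a ∧ ∀ b, b = a ∨ b = a' := by
    clear ha; revert a; decide
  have hsum : ∀ x, r a * ψ (Function.update x k a) + r a' * ψ (Function.update x k a') = 0 := by
    intro x
    rw [← hr x, Fintype.sum_eq_add a a' haa'.symm]
    rintro b ⟨h1, h2⟩
    rcases huniv b with h | h <;> contradiction
  have hS : ({k} : Finset (Fin 4)) ≠ Finset.univ := by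
    intro hk
    have := congrArg Finset.card hk
    simp at this
  refine h {k} (Finset.singleton_ne_empty k) hS
    -- The relation makes slice `a` equal to -(r a' / r a) times slice `a'`, so the state is a
    -- product of a vector of party `k` with slice `a'`.
    ⟨fun y => if y ⟨k, Finset.mem_singleton_self k⟩ = a then -(r a' / r a) else 1,
      fun y => ψ fun i => if hi : i ∈ ({k} : Finset (Fin 4)) then a' else y ⟨i, hi⟩, fun x => ?_⟩
  have hup : (fun i => if hi : i ∈ ({k} : Finset (Fin 4)) then a' else x i)
      = Function.update x k a' := by
    funext i
    by_cases hi : i = k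
    · subst hi; simp
    · simp [hi]
  simp only [hup]
  rcases huniv (x k) with hx | hx
  · rw [if_pos hx]
    have h1 := hsum x
    rw [show Function.update x k a = x by rw [← hx, Function.update_eq_self]] at h1
    field_simp
    linear_combination h1
  · rw [if_neg (by rw [hx]; exact haa'), one_mul, ← hx, Function.update_eq_self]

theorem sum_mul_localApply_update {d e : Fin 4 → ℕ} (A : ∀ i, Matrix (Fin (e i)) (Fin (d i)) ℂ)
    (ψ : StateSpace d) (k : Fin 4) (r : Fin (e k) → ℂ) (hr : Matrix.vecMul r (A k) = 0)
    (x : ∀ i, Fin (e i)) : ∑ b, r b * localApply A ψ (Function.update x k b) = 0 := by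
  simp only [localApply, Finset.mul_sum]
  rw [Finset.sum_comm]
  refine Finset.sum_eq_zero fun y _ => ?_
  have hprod : ∀ b, r b * ((∏ i, A i (Function.update x k b i) (y i)) * ψ y)
      = r b * A k b (y k) * ((∏ i ∈ Finset.univ.erase k, A i (x i) (y i)) * ψ y) := by
    intro b
    rw [← Finset.mul_prod_erase _ _ (Finset.mem_univ k), Function.update_self,
      Finset.prod_congr rfl fun i hi => by
        rw [Function.update_of_ne (Finset.ne_of_mem_erase hi)]]
    ring
  rw [Finset.sum_congr rfl fun b _ => hprod b, ← Finset.sum_mul]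
  have : ∑ b, r b * A k b (y k) = Matrix.vecMul r (A k) (y k) := rfl
  rw [this, hr, Pi.zero_apply, zero_mul]

/-- A left null vector of one factor would be a linear relation between the two slices of the image
along that party. -/
theorem det_ne_zero_of_fullyEntangled_localApply
    {A : Fin 4 → Matrix (Fin 2) (Fin 2) ℂ} {ψ : FourQubit}
    (h : FullyEntangled (localApply (d := fun _ => 2) (e := fun _ => 2) A ψ)) (k : Fin 4) :
    (A k).det ≠ 0 := by
  intro hdet
  obtain ⟨r, hr0, hr⟩ := Matrix.exists_vecMul_eq_zero_iff.mpr hdet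
  exact hr0 (h.eq_zero_of_slice k r (sum_mul_localApply_update
    (d := fun _ => 2) (e := fun _ => 2) A ψ k r hr))

theorem FullyEntangled.localApply {A : Fin 4 → Matrix (Fin 2) (Fin 2) ℂ} {ψ : FourQubit}
    (h : FullyEntangled ψ) (hA : ∀ i, (A i).det ≠ 0) :
    FullyEntangled (localApply (d := fun _ => 2) (e := fun _ => 2) A ψ) := by
  rintro S h1 h2 ⟨u, v, huv⟩
  refine h S h1 h2 ⟨fun x => ∑ y, (∏ i, (A i.1)⁻¹ (x i) (y i)) * u y,
    fun x => ∑ y, (∏ i, (A i.1)⁻¹ (x i) (y i)) * v y, fun x => ?_⟩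
  have hinv : ψ = _root_.localApply (d := fun _ => 2) (e := fun _ => 2) (fun i => (A i)⁻¹)
      (_root_.localApply (d := fun _ => 2) (e := fun _ => 2) A ψ) :=
    (localApply_eq_of_left_inverse
      (fun i => Matrix.nonsing_inv_mul _ (isUnit_iff_ne_zero.mpr (hA i))) ψ).symm
  rw [hinv, _root_.localApply, Finset.sum_mul_sum, ← Fintype.sum_prod_type']
  refine Fintype.sum_equiv (Equiv.piEquivPiSubtypeProd (· ∈ S) fun _ => Fin 2) _ _ fun y => ?_
  rw [huv y, ← Fintype.prod_subtype_mul_prod_subtype (· ∈ S)]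
  simp only [Equiv.piEquivPiSubtypeProd_apply]
  rw [mul_mul_mul_comm]
  congr!

/-- If a product operator annihilates a fully entangled state and all factors but one are
injective, the remaining factor vanishes. -/
theorem FullyEntangled.eq_zero_of_localApply {e : Fin 4 → ℕ} {ψ : FourQubit}
    (h : FullyEntangled ψ) {A : ∀ i, Matrix (Fin (e i)) (Fin 2) ℂ} {k : Fin 4}
    (hA : ∀ i, i ≠ k → ∃ L : Matrix (Fin 2) (Fin (e i)) ℂ, L * A i = 1)
    (h0 : _root_.localApply (d := fun _ => 2) A ψ = 0) : A k = 0 := by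
  ext a b
  have hL : ∀ i, ∃ L : Matrix (Fin 2) (Fin (e i)) ℂ, i ≠ k → L * A i = 1 := by
    intro i
    by_cases hi : i = k
    · exact ⟨0, fun h => absurd hi h⟩
    · obtain ⟨L, hL⟩ := hA i hi
      exact ⟨L, fun _ => hL⟩
  choose L hL using hL
  -- All rows of `E` are the unit vector `a`, so `E * A k` has row `a` of `A k` in both rows; with
  -- left inverses elsewhere, that row becomes a relation between the slices of `ψ`.
  let E : Matrix (Fin 2) (Fin (e k)) ℂ := Matrix.of fun _ c => if c = a then 1 else 0
  have hN := localApply_localApply (d := fun _ => 2) (f := fun _ => 2) (Function.update L k E) A ψ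
  rw [h0, localApply_zero] at hN
  have hr := h.eq_zero_of_slice k (A k a) fun x => by
    have := congrFun hN x
    rw [localApply_single (k := k) (fun i hi => by
      rw [Function.update_of_ne hi, hL i hi])] at this
    rw [Pi.zero_apply] at this
    rw [this]
    refine Finset.sum_congr rfl fun b _ => ?_
    simp [Matrix.mul_apply, E]
  rw [hr]; rfl

end Entanglement

/-! ### From protocols to separable measurements. -/

section LOCC

/-- By completeness the branch vectors of a round cannot all vanish; following a nonzero branch to
its end composes its Kraus operators into one product operator. -/
theorem LOCCTo.exists_localApply {φ : FourQubit} {d : Fin 4 → ℕ} {ψ : StateSpace d}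
    (h : LOCCTo φ ψ) : ψ ≠ 0 → ∃ (A : ∀ i, Matrix (Fin 2) (Fin (d i)) ℂ) (c : ℂ), c ≠ 0 ∧
      localApply (e := fun _ => 2) A ψ = c • φ := by
  induction h with
  | done c ψ h =>
    intro h0
    refine ⟨fun _ => 1, c, ?_, by rw [localApply_one, h]⟩
    rintro rfl
    exact h0 (by simp [h])
  | @round d ψ k m e K complete isometry next ih =>
    intro h0
    obtain ⟨j, hj⟩ : ∃ j, localApply (K j) ψ ≠ 0 := by
      by_contra! hc
      apply h0
      have hsum := sum_piKron k (fun j i => (K j i).conjTranspose * K j i) (fun _ => 1) isometry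
        complete
      rw [piKron_one] at hsum
      rw [← Matrix.one_mulVec ψ, ← hsum, Matrix.sum_mulVec]
      refine Finset.sum_eq_zero fun j _ => ?_
      rw [piKron_mul, ← Matrix.mulVec_mulVec, ← localApply_eq (K j), hc j, Matrix.mulVec_zero]
    obtain ⟨A, c, hc, hA⟩ := ih j hj
    exact ⟨fun i => A i * K j i, c, hc, by rw [← localApply_localApply, hA]⟩

/-- The branches of a protocol between fully entangled states form a separable measurement with
invertible Kraus operators. -/
theorem LOCCTo.exists_kraus {φ : FourQubit} (hφ : FullyEntangled φ) {ψ₀ : FourQubit}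
    (h₀ : FullyEntangled ψ₀) {d : Fin 4 → ℕ} {ψ : StateSpace d} (h : LOCCTo φ ψ) :
    ∀ B : ∀ i, Matrix (Fin (d i)) (Fin 2) ℂ,
      (∀ i, ∃ L : Matrix (Fin 2) (Fin (d i)) ℂ, L * B i = 1) →
      ψ = localApply (d := fun _ => 2) B ψ₀ →
      ∃ (ι : Type) (_ : Fintype ι) (A : ι → Fin 4 → Matrix (Fin 2) (Fin 2) ℂ),
        (∀ j, ∃ c : ℂ, c ≠ 0 ∧
          localApply (d := fun _ => 2) (e := fun _ => 2) (A j) ψ₀ = c • φ) ∧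
        ∑ j, piKron (d := fun _ => 2) (e := fun _ => 2) (fun i => (A j i).conjTranspose * A j i) =
          piKron (d := fun _ => 2) (e := fun _ => 2) fun i => (B i).conjTranspose * B i := by
  induction h with
  | done c ψ h =>
    intro B hB hψ
    refine ⟨Unit, inferInstance, fun _ => B, fun _ => ⟨c, ?_, by rw [← hψ, h]⟩, by simp⟩
    rintro rfl
    choose L hL using hB
    apply h₀.ne_zero
    rw [← localApply_eq_of_left_inverse hL ψ₀, ← hψ, h, zero_smul, localApply_zero]
  | @round d ψ k m e K complete isometry next ih =>
    intro B hB hψ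
    have key : ∀ j, ∃ (ι : Type) (_ : Fintype ι) (A : ι → Fin 4 → Matrix (Fin 2) (Fin 2) ℂ),
        (∀ l, ∃ c : ℂ, c ≠ 0 ∧
          localApply (d := fun _ => 2) (e := fun _ => 2) (A l) ψ₀ = c • φ) ∧
        ∑ l, piKron (d := fun _ => 2) (e := fun _ => 2) (fun i => (A l i).conjTranspose * A l i) =
          piKron (d := fun _ => 2) (e := fun _ => 2)
            fun i => (K j i * B i).conjTranspose * (K j i * B i) := by
      intro j
      have hne : ∀ i, i ≠ k → ∃ L : Matrix (Fin 2) (Fin (e j i)) ℂ, L * (K j i * B i) = 1 := by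
        intro i hi
        obtain ⟨L, hL⟩ := hB i
        refine ⟨L * (K j i).conjTranspose, ?_⟩
        rw [Matrix.mul_assoc, ← Matrix.mul_assoc _ (K j i), isometry j i hi, Matrix.one_mul, hL]
      have hst : localApply (K j) ψ = localApply (d := fun _ => 2) (fun i => K j i * B i) ψ₀ := by
        rw [hψ, localApply_localApply]
      by_cases hk : ∃ L : Matrix (Fin 2) (Fin (e j k)) ℂ, L * (K j k * B k) = 1
      · refine ih j _ (fun i => ?_) hst
        by_cases hi : i = k
        · subst hi; exact hk
        · exact hne i hi
      -- A nonzero branch would still reach `φ`, so the rest of the protocol would make party `k`'s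
      -- operator invertible and provide the left inverse excluded here.
      · have hzero : localApply (K j) ψ = 0 := by
          by_contra hnz
          obtain ⟨A, c, hc, hA⟩ := (next j).exists_localApply hnz
          rw [hst, localApply_localApply] at hA
          have hFE := hφ.smul hc
          rw [← hA] at hFE
          have hdet := det_ne_zero_of_fullyEntangled_localApply hFE k
          refine hk ⟨(A k * (K j k * B k))⁻¹ * A k, ?_⟩
          rw [Matrix.mul_assoc, Matrix.nonsing_inv_mul _ (isUnit_iff_ne_zero.mpr hdet)]
        have hKB : K j k * B k = 0 := h₀.eq_zero_of_localApply hne (hst ▸ hzero)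
        -- The factor of party `k` is zero, so this outcome contributes no branches and the zero
        -- operator.
        refine ⟨Empty, inferInstance, Empty.elim, fun l => l.elim, ?_⟩
        ext x y
        simp only [Finset.univ_eq_empty, Finset.sum_empty, piKron, Matrix.of_apply,
          Matrix.zero_apply]
        rw [Finset.prod_eq_zero (Finset.mem_univ k) (by rw [hKB]; simp)]
    choose ι hι A hA hsum using key
    refine ⟨Σ j, ι j, inferInstance, fun l => A l.1 l.2, fun l => hA l.1 l.2, ?_⟩
    rw [Fintype.sum_sigma]
    simp only [hsum]
    refine sum_piKron k (e := fun _ => 2) (d := fun _ => 2) _ _ (fun j i hi => ?_) ?_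
    · rw [Matrix.conjTranspose_mul, Matrix.mul_assoc, ← Matrix.mul_assoc _ (K j i),
        isometry j i hi, Matrix.one_mul]
    · have : ∀ j, (K j k * B k).conjTranspose * (K j k * B k)
          = (B k).conjTranspose * ((K j k).conjTranspose * K j k) * B k := fun j => by
        simp only [Matrix.conjTranspose_mul, Matrix.mul_assoc]
      simp only [this]
      rw [← Matrix.sum_mul, ← Matrix.mul_sum, complete, Matrix.mul_one]

end LOCC

/-! ### Pauli matrices as a basis, and their commutation signs. -/

section Pauli

/-- The identity and the Pauli matrices. -/
noncomputable def pauliBasis : Fin 4 → Matrix (Fin 2) (Fin 2) ℂ :=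
  ![1, !![0, 1; 1, 0], !![0, -Complex.I; Complex.I, 0], !![1, 0; 0, -1]]

theorem pauliBasis_succ (w : Fin 3) : pauliBasis w.succ = pauli w := by
  fin_cases w <;> rfl

/-- Two Pauli matrices commute or anticommute. -/
def pauliSign (w k : Fin 4) : ℝ := if w = 0 ∨ k = 0 ∨ w = k then 1 else -1

theorem pauliBasis_mul_mul (w k : Fin 4) :
    pauliBasis w * pauliBasis k * pauliBasis w = (pauliSign w k : ℂ) • pauliBasis k := by
  fin_cases w <;> fin_cases k <;> ext i j <;> fin_cases i <;> fin_cases j <;>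
    simp [pauliBasis, pauliSign]

theorem pauliBasis_mul_self (w : Fin 4) : pauliBasis w * pauliBasis w = 1 := by
  fin_cases w <;> ext i j <;> fin_cases i <;> fin_cases j <;> simp [pauliBasis]

theorem pauliBasis_conjTranspose (w : Fin 4) : (pauliBasis w).conjTranspose = pauliBasis w := by
  fin_cases w <;> ext i j <;> fin_cases i <;> fin_cases j <;>
    simp [pauliBasis, Matrix.conjTranspose_apply]

theorem exists_pauliBasis_transpose (w : Fin 4) :
    ∃ t : ℂ, t ≠ 0 ∧ (pauliBasis w).transpose = t • pauliBasis w := by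
  by_cases hw : w = 2
  · subst hw
    refine ⟨-1, by norm_num, ?_⟩
    ext i j
    fin_cases i <;> fin_cases j <;> simp [pauliBasis]
  · refine ⟨1, one_ne_zero, ?_⟩
    fin_cases w <;> first | exact absurd rfl hw | skip
    all_goals ext i j; fin_cases i <;> fin_cases j <;> simp [pauliBasis]

theorem pauliBasis_ne_zero (w : Fin 4) : pauliBasis w ≠ 0 := by
  intro h
  have := pauliBasis_mul_self w
  rw [h, Matrix.zero_mul] at this
  exact zero_ne_one this

theorem sum_trace_pauliBasis (V : Matrix (Fin 2) (Fin 2) ℂ) :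
    V = (1 / 2 : ℂ) • ∑ l, (pauliBasis l * V).trace • pauliBasis l := by
  ext i j
  fin_cases i <;> fin_cases j <;>
    simp [Fin.sum_univ_four, pauliBasis, Matrix.trace_fin_two, Matrix.mul_apply,
      Fin.sum_univ_two]
  · ring
  · linear_combination (1 / 2) * (V 0 1 - V 1 0) * Complex.I_sq
  · linear_combination (-1 / 2) * (V 0 1 - V 1 0) * Complex.I_sq
  · ring

theorem trace_pauliBasis_conj (w k : Fin 4) (V : Matrix (Fin 2) (Fin 2) ℂ) :
    (pauliBasis k * (pauliBasis w * V * pauliBasis w)).trace =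
      pauliSign w k * (pauliBasis k * V).trace := by
  have h : pauliBasis k * (pauliBasis w * V * pauliBasis w)
      = (pauliBasis k * pauliBasis w * V) * pauliBasis w := by simp only [Matrix.mul_assoc]
  rw [h, Matrix.trace_mul_comm, ← Matrix.mul_assoc, ← Matrix.mul_assoc, pauliBasis_mul_mul,
    Matrix.smul_mul, Matrix.trace_smul, smul_eq_mul]

end Pauli

/-! ### The seed state as an operator that is diagonal in the Pauli basis. -/

section Seed

theorem sum_fourQubit {M : Type*} [AddCommMonoid M] (f : (Fin 4 → Fin 2) → M) :
    ∑ y, f y = ∑ a, ∑ b, ∑ c, ∑ d, f ![a, b, c, d] := by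
  have h : Function.Bijective fun t : Fin 2 × Fin 2 × Fin 2 × Fin 2 =>
      (![t.1, t.2.1, t.2.2.1, t.2.2.2] : Fin 4 → Fin 2) := by decide
  rw [← Fintype.sum_bijective _ h (fun t => f ![t.1, t.2.1, t.2.2.1, t.2.2.2]) f fun _ => rfl]
  simp only [Fintype.sum_prod_type]

theorem GenericSeed.sq_ne {p : Fin 4 → ℂ} (hp : GenericSeed p) {i j : Fin 4} (h : i ≠ j) :
    p i ^ 2 ≠ p j ^ 2 := fun he => h (hp.1 he)

/-- For i in S and k outside S compare the amplitudes at 0, eᵢ + eₖ and eᵢ. The first two are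
nonzero because the squared parameters are distinct, the third vanishes by parity, and a product u ·
v would have to vanish at one of the first two as well. -/
theorem GenericSeed.fullyEntangled {p : Fin 4 → ℂ} (hp : GenericSeed p) :
    FullyEntangled (seed p) := by
  have hadd : ∀ i j, i ≠ j → (p i + p j) / 2 ≠ 0 := fun i j h h0 =>
    hp.sq_ne h (by linear_combination 2 * (p i - p j) * h0)
  have hsub : ∀ i j, i ≠ j → (p i - p j) / 2 ≠ 0 := fun i j h h0 =>
    hp.sq_ne h (by linear_combination 2 * (p i + p j) * h0)
  rintro S h1 h2 ⟨u, v, huv⟩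
  obtain ⟨i, hi⟩ := Finset.nonempty_iff_ne_empty.mpr h1
  obtain ⟨k, hk⟩ : ∃ k, k ∉ S := by
    by_contra! hc
    exact h2 (Finset.eq_univ_of_forall hc)
  have hik : i ≠ k := fun h => hk (h ▸ hi)
  have h00 := huv 0
  have h11 := huv fun l => if l = i ∨ l = k then 1 else 0
  have h10 := huv fun l => if l = i then 1 else 0
  have e1 : (fun l : {l // l ∈ S} => if l.1 = i ∨ l.1 = k then (1 : Fin 2) else 0)
      = fun l => if l.1 = i then 1 else 0 := by
    funext l
    have : l.1 ≠ k := fun h => hk (h ▸ l.2)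
    simp [this]
  have e2 : (fun l : {l // l ∉ S} => if l.1 = i then (1 : Fin 2) else 0) = fun l => 0 := by
    funext l
    have : l.1 ≠ i := fun h => l.2 (h ▸ hi)
    simp [this]
  rw [e1] at h11
  rw [e2] at h10
  have z : seed p (fun l => if l = i then 1 else 0) = 0 := by
    fin_cases i <;> simp [seed, funext_iff, Fin.forall_fin_succ]
  have n0 : seed p 0 ≠ 0 := by
    have : seed p 0 = (p 0 + p 3) / 2 := by simp [seed, funext_iff, Fin.forall_fin_succ]
    rw [this]; exact hadd 0 3 (by decide)
  have n1 : seed p (fun l => if l = i ∨ l = k then 1 else 0) ≠ 0 := by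
    have : (seed p (fun l => if l = i ∨ l = k then 1 else 0) = (p 0 - p 3) / 2) ∨
      (seed p (fun l => if l = i ∨ l = k then 1 else 0) = (p 1 + p 2) / 2) ∨
      (seed p (fun l => if l = i ∨ l = k then 1 else 0) = (p 1 - p 2) / 2) := by
      clear h00 h11 h10 e1 e2 z n0 hi hk
      fin_cases i <;> fin_cases k <;> first | exact absurd rfl hik | skip
      all_goals simp [seed, funext_iff, Fin.forall_fin_succ]
    rcases this with h | h | h <;> rw [h]
    exacts [hsub 0 3 (by decide), hadd 1 2 (by decide), hsub 1 2 (by decide)]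
  rw [h00] at n0
  rw [h11] at n1
  rw [h10] at z
  rcases mul_eq_zero.mp z with h | h
  · exact n1 (by rw [h, zero_mul])
  · exact n0 (mul_eq_zero_of_right _ h)

/-- The seed state as a map from the last two parties to the first two. It is diagonal in the Bell
basis, that is, in the basis of the Pauli matrices. -/
noncomputable def seedMap (p : Fin 4 → ℂ) (V : Matrix (Fin 2) (Fin 2) ℂ) :
    Matrix (Fin 2) (Fin 2) ℂ :=
  !![(p 0 + p 3) / 2 * V 0 0 + (p 0 - p 3) / 2 * V 1 1,
      (p 1 + p 2) / 2 * V 0 1 + (p 1 - p 2) / 2 * V 1 0;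
    (p 1 - p 2) / 2 * V 0 1 + (p 1 + p 2) / 2 * V 1 0,
      (p 0 - p 3) / 2 * V 0 0 + (p 0 + p 3) / 2 * V 1 1]

theorem seedMap_smul (p : Fin 4 → ℂ) (c : ℂ) (V : Matrix (Fin 2) (Fin 2) ℂ) :
    seedMap p (c • V) = c • seedMap p V := by
  ext i j
  fin_cases i <;> fin_cases j <;> simp [seedMap] <;> ring

theorem seedMap_pauliBasis (p : Fin 4 → ℂ) (k : Fin 4) :
    seedMap p (pauliBasis k) = p k • pauliBasis k := by
  ext i j
  fin_cases k <;> fin_cases i <;> fin_cases j <;> simp [seedMap, pauliBasis] <;> ring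

theorem trace_pauliBasis_seedMap (p : Fin 4 → ℂ) (k : Fin 4) (V : Matrix (Fin 2) (Fin 2) ℂ) :
    (pauliBasis k * seedMap p V).trace = p k * (pauliBasis k * V).trace := by
  fin_cases k <;> simp [seedMap, pauliBasis, Matrix.trace_fin_two, Matrix.vecMul, dotProduct,
    Fin.sum_univ_two] <;> ring

/-- The transpose of the adjugate. -/
def spinFlip (V : Matrix (Fin 2) (Fin 2) ℂ) : Matrix (Fin 2) (Fin 2) ℂ := V.adjugate.transpose

theorem spinFlip_mul_mul (A V B : Matrix (Fin 2) (Fin 2) ℂ) :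
    spinFlip (A * V * B.transpose) = A.adjugate.transpose * spinFlip V * B.adjugate := by
  simp only [spinFlip, Matrix.adjugate_mul_distrib, Matrix.transpose_mul, ← Matrix.mul_assoc,
    Matrix.adjugate_transpose, Matrix.transpose_transpose]

/-- On 2 × 2 matrices `spinFlip` is linear and diagonal in the Pauli basis with eigenvalues ±1, so
its signs cancel and the eigenvalues of `seedMap` get squared. -/
theorem seedMap_spinFlip_sq (p : Fin 4 → ℂ) (V : Matrix (Fin 2) (Fin 2) ℂ) :
    seedMap p (spinFlip (seedMap p (spinFlip V))) = seedMap (fun i => p i ^ 2) V := by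
  ext i j
  fin_cases i <;> fin_cases j <;> simp [seedMap, spinFlip, Matrix.adjugate_fin_two] <;> ring

theorem seedMap_apply (p : Fin 4 → ℂ) (V : Matrix (Fin 2) (Fin 2) ℂ) (i j : Fin 2) :
    seedMap p V i j = ∑ k, ∑ l, seed p ![i, j, k, l] * V k l := by
  fin_cases i <;> fin_cases j <;> simp [seedMap, seed, Fin.sum_univ_two]

theorem seedMap_apply_swap (p : Fin 4 → ℂ) (V : Matrix (Fin 2) (Fin 2) ℂ) (i j : Fin 2) :
    seedMap p V i j = ∑ k, ∑ l, seed p ![k, l, i, j] * V k l := by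
  fin_cases i <;> fin_cases j <;> simp [seedMap, seed, Fin.sum_univ_two]

theorem mul_seedMap_mul (p : Fin 4 → ℂ) (S : Fin 4 → Matrix (Fin 2) (Fin 2) ℂ)
    (V : Matrix (Fin 2) (Fin 2) ℂ) (i j : Fin 2) :
    (S 0 * seedMap p ((S 2).transpose * V * S 3) * (S 1).transpose) i j = ∑ k, ∑ l,
      localApply (d := fun _ => 2) (e := fun _ => 2) S (seed p) ![i, j, k, l] * V k l := by
  simp only [Matrix.mul_apply, seedMap_apply, Fin.sum_univ_two, Matrix.transpose_apply, localApply,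
    sum_fourQubit, Fin.prod_univ_four]
  simp only [Matrix.cons_val]
  ring

theorem mul_seedMap_mul_swap (p : Fin 4 → ℂ) (S : Fin 4 → Matrix (Fin 2) (Fin 2) ℂ)
    (V : Matrix (Fin 2) (Fin 2) ℂ) (i j : Fin 2) :
    (S 2 * seedMap p ((S 0).transpose * V * S 1) * (S 3).transpose) i j = ∑ k, ∑ l,
      localApply (d := fun _ => 2) (e := fun _ => 2) S (seed p) ![k, l, i, j] * V k l := by
  simp only [Matrix.mul_apply, seedMap_apply_swap, Fin.sum_univ_two, Matrix.transpose_apply,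
    localApply, sum_fourQubit, Fin.prod_univ_four]
  simp only [Matrix.cons_val]
  ring

/-- The seed is unchanged when the pair of the first two parties is exchanged with the pair of the
last two, so a symmetry can be read in both directions. -/
theorem localApply_seed_eq_seedMap {p : Fin 4 → ℂ} {S : Fin 4 → Matrix (Fin 2) (Fin 2) ℂ} {c : ℂ}
    (h : localApply (d := fun _ => 2) (e := fun _ => 2) S (seed p) = c • seed p)
    (V : Matrix (Fin 2) (Fin 2) ℂ) :
    S 0 * seedMap p ((S 2).transpose * V * S 3) * (S 1).transpose = c • seedMap p V ∧
    S 2 * seedMap p ((S 0).transpose * V * S 1) * (S 3).transpose = c • seedMap p V := by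
  constructor <;> ext i j
  · rw [mul_seedMap_mul, h, Matrix.smul_apply, seedMap_apply]
    simp only [Pi.smul_apply, smul_eq_mul, Finset.mul_sum, mul_assoc]
  · rw [mul_seedMap_mul_swap, h, Matrix.smul_apply, seedMap_apply_swap]
    simp only [Pi.smul_apply, smul_eq_mul, Finset.mul_sum, mul_assoc]

theorem localApply_pauliBasis_seed (p : Fin 4 → ℂ) (w : Fin 4) :
    localApply (d := fun _ => 2) (e := fun _ => 2) (fun _ => pauliBasis w) (seed p) = seed p := by
  have hv : ∀ x : Fin 4 → Fin 2, x = ![x 0, x 1, x 2, x 3] := fun x => by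
    ext i; fin_cases i <;> rfl
  ext x
  rw [hv x]
  generalize x 0 = a, x 1 = b, x 2 = c, x 3 = d
  simp only [localApply, sum_fourQubit, Fin.prod_univ_four, Matrix.cons_val]
  fin_cases w
  · simp [pauliBasis, Matrix.one_apply]
  all_goals
    fin_cases a <;> fin_cases b <;> fin_cases c <;> fin_cases d <;>
      simp [pauliBasis, Fin.sum_univ_two, seed]

/-- `spinFlip` replaces A and B by their inverse transposes up to determinants, which cancels the
transposes on the input side. Going to the other pair of parties and back eliminates C and D except
for their determinants: V ↦ A V Bᵀ intertwines the squared seed map with itself up to a scalar. -/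
theorem seedMap_conj {p : Fin 4 → ℂ} {A B C D : Matrix (Fin 2) (Fin 2) ℂ} {c : ℂ}
    (h₁ : ∀ V, A * seedMap p (C.transpose * V * D) * B.transpose = c • seedMap p V)
    (h₂ : ∀ V, C * seedMap p (A.transpose * V * B) * D.transpose = c • seedMap p V)
    (V : Matrix (Fin 2) (Fin 2) ℂ) :
    c ^ 2 • seedMap (fun i => p i ^ 2) (A * V * B.transpose) =
      (A.det * B.det * C.det * D.det) •
        (A * seedMap (fun i => p i ^ 2) V * B.transpose) := by
  have key : ∀ A B C D : Matrix (Fin 2) (Fin 2) ℂ,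
      (∀ V, C * seedMap p (A.transpose * V * B) * D.transpose = c • seedMap p V) → ∀ V,
      c • seedMap p (spinFlip (A * V * B.transpose)) =
        (A.det * B.det) • (C * seedMap p (spinFlip V) * D.transpose) := by
    intro A B C D h V
    rw [spinFlip_mul_mul, ← h]
    have : A.transpose * (A.adjugate.transpose * spinFlip V * B.adjugate) * B
        = (A.det * B.det) • spinFlip V := by
      have h1 : A.transpose * A.adjugate.transpose = A.det • 1 := by
        rw [← Matrix.transpose_mul, Matrix.adjugate_mul, Matrix.transpose_smul,
          Matrix.transpose_one]
      calc _ = (A.transpose * A.adjugate.transpose) * spinFlip V * (B.adjugate * B) := by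
            simp only [Matrix.mul_assoc]
        _ = _ := by
            rw [h1, Matrix.adjugate_mul]
            simp [smul_smul, mul_comm]
    rw [this, seedMap_smul, Matrix.mul_smul, Matrix.smul_mul]
  have hs : ∀ (t : ℂ) (W : Matrix (Fin 2) (Fin 2) ℂ), spinFlip (t • W) = t • spinFlip W := by
    intro t W
    ext i j
    fin_cases i <;> fin_cases j <;> simp [spinFlip, Matrix.adjugate_fin_two]
  rw [← seedMap_spinFlip_sq, ← seedMap_spinFlip_sq, sq, mul_smul, ← seedMap_smul, ← hs,
    key A B C D h₂, hs, seedMap_smul, smul_comm, key C D A B h₁, smul_smul]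
  congr 1
  ring

end Seed

/-! ### The local symmetries of a generic seed. -/

section Stabilizer

/-- Multiplication by a nonzero `q` is injective, so mapping the finite set of squares into itself
it permutes that set. -/
theorem GenericSeed.eq_one_of_forall_exists {p : Fin 4 → ℂ} (hp : GenericSeed p) {q : ℂ}
    (hq : q ≠ 0) (h : ∀ k, ∃ l, q * p k ^ 2 = p l ^ 2) : q = 1 := by
  choose f hf using h
  have hinj : Function.Injective f := fun a b hab =>
    hp.1 (mul_left_cancel₀ hq ((hf a).trans (hab ▸ (hf b).symm)))
  refine hp.2 q (Set.Subset.antisymm ?_ ?_)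
  · rintro _ ⟨k, rfl⟩
    exact ⟨f k, (hf k).symm⟩
  · rintro _ ⟨l, rfl⟩
    obtain ⟨k, rfl⟩ := Finite.injective_iff_surjective.mp hinj l
    exact ⟨k, hf k⟩

/-- A linear map commuting with the seed map up to a factor is diagonal in the Bell basis. -/
theorem GenericSeed.exists_smul_pauliBasis {p : Fin 4 → ℂ} (hp : GenericSeed p)
    {A B : Matrix (Fin 2) (Fin 2) ℂ} (hA : A.det ≠ 0) (hB : B.det ≠ 0) {q : ℂ} (hq : q ≠ 0)
    (h : ∀ V, seedMap (fun i => p i ^ 2) (A * V * B.transpose) =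
      q • (A * seedMap (fun i => p i ^ 2) V * B.transpose)) (k : Fin 4) :
    ∃ t : ℂ, t ≠ 0 ∧ A * pauliBasis k * B.transpose = t • pauliBasis k := by
  have hBt : IsUnit B.transpose.det := by
    rw [Matrix.det_transpose]; exact isUnit_iff_ne_zero.mpr hB
  have hne : ∀ k, A * pauliBasis k * B.transpose ≠ 0 := by
    intro k h0
    apply pauliBasis_ne_zero k
    have : A⁻¹ * (A * pauliBasis k * B.transpose) * B.transpose⁻¹ = pauliBasis k := by
      rw [Matrix.mul_assoc A, Matrix.nonsing_inv_mul_cancel_left _ _ (isUnit_iff_ne_zero.mpr hA),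
        Matrix.mul_nonsing_inv_cancel_right _ _ hBt]
    rw [← this, h0, Matrix.mul_zero, Matrix.zero_mul]
  -- The image of the eigenvector `pauliBasis k` is an eigenvector for `q * p k ^ 2`. Any Pauli
  -- component it has identifies this number with some `p l ^ 2`, which forces `q = 1` and then `l =
  -- k`.
  have hcoef : ∀ k l, (pauliBasis l * (A * pauliBasis k * B.transpose)).trace ≠ 0 →
      q * p k ^ 2 = p l ^ 2 := by
    intro k l hkl
    have h1 := congrArg (fun W => (pauliBasis l * W).trace) (h (pauliBasis k))
    simp only [seedMap_pauliBasis, trace_pauliBasis_seedMap, Matrix.mul_smul, Matrix.smul_mul,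
      Matrix.trace_smul, smul_eq_mul] at h1
    apply mul_right_cancel₀ hkl
    rw [h1]; ring
  have hex : ∀ k, ∃ l, (pauliBasis l * (A * pauliBasis k * B.transpose)).trace ≠ 0 := by
    intro k
    by_contra! hc
    apply hne k
    rw [sum_trace_pauliBasis (A * pauliBasis k * B.transpose)]
    simp [hc]
  have hq1 : q = 1 := hp.eq_one_of_forall_exists hq fun k => by
    obtain ⟨l, hl⟩ := hex k
    exact ⟨l, hcoef k l hl⟩
  have hzero : ∀ l, l ≠ k → (pauliBasis l * (A * pauliBasis k * B.transpose)).trace = 0 := by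
    intro l hl
    by_contra hc
    have := hcoef k l hc
    rw [hq1, one_mul] at this
    exact hp.sq_ne hl this.symm
  have hsum := sum_trace_pauliBasis (A * pauliBasis k * B.transpose)
  rw [Finset.sum_eq_single k (fun l _ hl => by rw [hzero l hl, zero_smul]) (by simp),
    smul_smul] at hsum
  refine ⟨_, fun h0 => hne k ?_, hsum⟩
  rw [hsum, h0, zero_smul]

/-- The case `k = 0` makes `B.transpose` a multiple of the inverse of `A`; the others say that `A`
commutes with X and Z up to factors, which only multiples of the four basis matrices do. -/
theorem exists_pauliBasis_of_conj {A B : Matrix (Fin 2) (Fin 2) ℂ} (hA : A.det ≠ 0)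
    (h : ∀ k, ∃ t : ℂ, t ≠ 0 ∧ A * pauliBasis k * B.transpose = t • pauliBasis k) :
    ∃ (w : Fin 4) (s t : ℂ), A = s • pauliBasis w ∧ B = t • pauliBasis w := by
  obtain ⟨t₀, h₀, e₀⟩ := h 0
  obtain ⟨tx, hx, ex⟩ := h 1
  obtain ⟨tz, hz, ez⟩ := h 3
  have hP0 : pauliBasis 0 = 1 := rfl
  rw [hP0, Matrix.mul_one] at e₀
  have hBA : B.transpose * A = t₀ • 1 := by
    have h1 : A * (t₀⁻¹ • B.transpose) = 1 := by
      rw [Matrix.mul_smul, e₀, smul_smul, inv_mul_cancel₀ h₀, one_smul]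
    have h2 := mul_eq_one_comm.mp h1
    rw [Matrix.smul_mul] at h2
    rw [← h2, smul_smul, mul_inv_cancel₀ h₀, one_smul]
  have hcomm : ∀ (k : Fin 4) (t : ℂ), A * pauliBasis k * B.transpose = t • pauliBasis k →
      t₀ • (A * pauliBasis k) = t • (pauliBasis k * A) := by
    intro k t hk
    rw [← Matrix.smul_mul t, ← hk, Matrix.mul_assoc, hBA, Matrix.mul_smul, Matrix.mul_one]
  have cx := hcomm 1 tx ex
  have cz := hcomm 3 tz ez
  have hAw : ∃ (w : Fin 4) (s : ℂ), A = s • pauliBasis w := by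
    have x00 := congrFun (congrFun cx 0) 0
    have x01 := congrFun (congrFun cx 0) 1
    have x10 := congrFun (congrFun cx 1) 0
    have x11 := congrFun (congrFun cx 1) 1
    have z00 := congrFun (congrFun cz 0) 0
    have z01 := congrFun (congrFun cz 0) 1
    have z10 := congrFun (congrFun cz 1) 0
    have z11 := congrFun (congrFun cz 1) 1
    simp [pauliBasis, Matrix.mul_apply, Fin.sum_univ_two, Matrix.vecMul, dotProduct]
      at x00 x01 x10 x11 z00 z01 z10 z11
    rw [Matrix.det_fin_two] at hA
    have hext : ∀ M : Matrix (Fin 2) (Fin 2) ℂ, A 0 0 = M 0 0 → A 0 1 = M 0 1 → A 1 0 = M 1 0 →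
        A 1 1 = M 1 1 → A = M := by
      intro M a b c d
      ext i j
      fin_cases i <;> fin_cases j
      exacts [a, b, c, d]
    -- Either `A` commutes with Z and is diagonal, or its diagonal vanishes; the relation with X
    -- then fixes the ratio of the two remaining entries up to sign.
    rcases z00 with ht | h00
    · subst ht
      have h01 : A 0 1 = 0 := mul_left_cancel₀ h₀ (by linear_combination (-1 / 2) * z01)
      have h10 : A 1 0 = 0 := mul_left_cancel₀ h₀ (by linear_combination (1 / 2) * z10)
      have hsq : (A 1 1 - A 0 0) * (A 1 1 + A 0 0) = 0 :=
        mul_left_cancel₀ h₀ (by linear_combination A 1 1 * x10 - A 0 0 * x01)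
      rcases mul_eq_zero.mp hsq with h | h
      · exact ⟨0, A 0 0, hext _ (by simp [pauliBasis]) (by simp [pauliBasis, h01])
          (by simp [pauliBasis, h10]) (by simp [pauliBasis]; linear_combination h)⟩
      · exact ⟨3, A 0 0, hext _ (by simp [pauliBasis]) (by simp [pauliBasis, h01])
          (by simp [pauliBasis, h10]) (by simp [pauliBasis]; linear_combination h)⟩
    · have h11 : A 1 1 = 0 := mul_left_cancel₀ h₀ (by rw [x10, h00]; ring)
      have hsq : (A 1 0 - A 0 1) * (A 1 0 + A 0 1) = 0 :=
        mul_left_cancel₀ h₀ (by linear_combination A 1 0 * x11 - A 0 1 * x00)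
      rcases mul_eq_zero.mp hsq with h | h
      · exact ⟨1, A 0 1, hext _ (by simp [pauliBasis, h00]) (by simp [pauliBasis])
          (by simp [pauliBasis]; linear_combination h) (by simp [pauliBasis, h11])⟩
      · refine ⟨2, Complex.I * A 0 1, hext _ (by simp [pauliBasis, h00]) ?_ ?_
          (by simp [pauliBasis, h11])⟩
        · simp [pauliBasis]; linear_combination A 0 1 * Complex.I_sq
        · simp [pauliBasis]; linear_combination h - A 0 1 * Complex.I_sq
  obtain ⟨w, s, hw⟩ := hAw
  obtain ⟨t, ht, htr⟩ := exists_pauliBasis_transpose w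
  have hs : s ≠ 0 := by
    rintro rfl
    exact hA (by simp [hw])
  refine ⟨w, s, t₀ * s⁻¹ * t, hw, ?_⟩
  have hB : B.transpose = (t₀ * s⁻¹) • pauliBasis w := by
    have h1 : s⁻¹ • pauliBasis w * A = 1 := by
      rw [hw, Matrix.smul_mul, Matrix.mul_smul, pauliBasis_mul_self, smul_smul,
        inv_mul_cancel₀ hs, one_smul]
    rw [mul_smul, ← mul_one B.transpose, ← mul_eq_one_comm.mp h1, ← Matrix.mul_assoc, hBA,
      Matrix.smul_mul, Matrix.one_mul]
  rw [← Matrix.transpose_transpose B, hB, Matrix.transpose_smul, htr, smul_smul]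

theorem pauliSign_mul_of_iff {w w' k : Fin 4}
    (h : (w' = 0 ∨ k = 0 ∨ w' = k) ↔ (w = 0 ∨ k = 0 ∨ w = k)) :
    pauliSign w' k * pauliSign w k = 1 := by
  unfold pauliSign
  by_cases hw : w = 0 ∨ k = 0 ∨ w = k
  · rw [if_pos hw, if_pos (h.mpr hw), one_mul]
  · rw [if_neg hw, if_neg (h.not.mpr hw)]; norm_num

theorem pauliSign_mul_of_not_iff {w w' k : Fin 4}
    (h : ¬ ((w' = 0 ∨ k = 0 ∨ w' = k) ↔ (w = 0 ∨ k = 0 ∨ w = k))) :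
    pauliSign w' k * pauliSign w k = -1 := by
  unfold pauliSign
  by_cases hw : w = 0 ∨ k = 0 ∨ w = k
  · rw [if_pos hw, if_neg (fun h' => h (iff_of_true h' hw)), mul_one]
  · rw [if_neg hw, if_pos (by_contra fun h' => h (iff_of_false h' hw)), one_mul]

theorem exists_pauliSign_eq : ∀ w w' : Fin 4,
    ∃ k₁ k₂ : Fin 4, k₁ ≠ k₂ ∧
      ((w' = 0 ∨ k₁ = 0 ∨ w' = k₁) ↔ (w = 0 ∨ k₁ = 0 ∨ w = k₁)) ∧
      ((w' = 0 ∨ k₂ = 0 ∨ w' = k₂) ↔ (w = 0 ∨ k₂ = 0 ∨ w = k₂)) := by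
  decide

theorem exists_pauliSign_ne : ∀ w w' : Fin 4, w ≠ w' →
    ∃ l₁ l₂ : Fin 4, l₁ ≠ l₂ ∧
      ¬ ((w' = 0 ∨ l₁ = 0 ∨ w' = l₁) ↔ (w = 0 ∨ l₁ = 0 ∨ w = l₁)) ∧
      ¬ ((w' = 0 ∨ l₂ = 0 ∨ w' = l₂) ↔ (w = 0 ∨ l₂ = 0 ∨ w = l₂)) := by
  decide

/-- The local symmetries of a generic seed state are the products of four equal Pauli matrices. -/
theorem GenericSeed.stabilizer {p : Fin 4 → ℂ} (hp : GenericSeed p)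
    {S : Fin 4 → Matrix (Fin 2) (Fin 2) ℂ} {c : ℂ} (hc : c ≠ 0)
    (h : localApply (d := fun _ => 2) (e := fun _ => 2) S (seed p) = c • seed p) :
    ∃ (w : Fin 4) (s : Fin 4 → ℂ), ∀ i, S i = s i • pauliBasis w := by
  have hFE := hp.fullyEntangled.smul hc
  rw [← h] at hFE
  have hdet := det_ne_zero_of_fullyEntangled_localApply hFE
  have h₁ := fun V => (localApply_seed_eq_seedMap h V).1
  have h₂ := fun V => (localApply_seed_eq_seedMap h V).2
  have hκ : ∀ x y : ℂ, ∀ V W : Matrix (Fin 2) (Fin 2) ℂ, x ≠ 0 → x • V = y • W →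
      V = (x⁻¹ * y) • W := by
    intro x y V W hx hxy
    rw [mul_smul, ← hxy, smul_smul, inv_mul_cancel₀ hx, one_smul]
  have hc2 : c ^ 2 ≠ 0 := pow_ne_zero 2 hc
  obtain ⟨w, s₀, s₁, e₀, e₁⟩ := exists_pauliBasis_of_conj (hdet 0)
    (hp.exists_smul_pauliBasis (hdet 0) (hdet 1)
      (mul_ne_zero (inv_ne_zero hc2)
        (mul_ne_zero (mul_ne_zero (mul_ne_zero (hdet 0) (hdet 1)) (hdet 2)) (hdet 3)))
      fun V => hκ _ _ _ _ hc2 (seedMap_conj h₁ h₂ V))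
  obtain ⟨w', s₂, s₃, e₂, e₃⟩ := exists_pauliBasis_of_conj (hdet 2)
    (hp.exists_smul_pauliBasis (hdet 2) (hdet 3)
      (mul_ne_zero (inv_ne_zero hc2)
        (mul_ne_zero (mul_ne_zero (mul_ne_zero (hdet 2) (hdet 3)) (hdet 0)) (hdet 1)))
      fun V => hκ _ _ _ _ hc2 (seedMap_conj h₂ h₁ V))
  have hww : w = w' := by
    obtain ⟨τ, hτ, htr⟩ := exists_pauliBasis_transpose w
    obtain ⟨τ', hτ', htr'⟩ := exists_pauliBasis_transpose w'
    have hsign : ∀ k, p k ≠ 0 →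
        (s₀ * s₁ * s₂ * s₃ * τ * τ') * (pauliSign w' k * pauliSign w k : ℝ) = c := by
      intro k hk
      have := h₁ (pauliBasis k)
      rw [e₀, e₁, e₂, e₃, Matrix.transpose_smul, Matrix.transpose_smul, htr, htr'] at this
      simp only [Matrix.smul_mul, Matrix.mul_smul, smul_smul, pauliBasis_mul_mul, seedMap_smul,
        seedMap_pauliBasis] at this
      have hcan := smul_left_injective ℂ (pauliBasis_ne_zero k) this
      apply mul_right_cancel₀ hk
      rw [← hcan]
      push_cast
      ring
    -- At most one parameter can vanish. Two labels of each relative sign therefore suffice to show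
    -- that different `w` and `w'` would give both `c` and `-c`.
    have hor : ∀ k l, k ≠ l → p k ≠ 0 ∨ p l ≠ 0 := by
      intro k l hkl
      by_contra! hc
      exact hp.sq_ne hkl (by rw [hc.1, hc.2])
    by_contra hne
    obtain ⟨k₁, k₂, l₁, l₂, hk, hl, a₁, a₂, b₁, b₂⟩ : ∃ k₁ k₂ l₁ l₂ : Fin 4, k₁ ≠ k₂ ∧ l₁ ≠ l₂ ∧
        pauliSign w' k₁ * pauliSign w k₁ = 1 ∧ pauliSign w' k₂ * pauliSign w k₂ = 1 ∧
        pauliSign w' l₁ * pauliSign w l₁ = -1 ∧ pauliSign w' l₂ * pauliSign w l₂ = -1 := by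
      obtain ⟨k₁, k₂, hk, a₁, a₂⟩ := exists_pauliSign_eq w w'
      obtain ⟨l₁, l₂, hl, b₁, b₂⟩ := exists_pauliSign_ne w w' hne
      exact ⟨k₁, k₂, l₁, l₂, hk, hl, pauliSign_mul_of_iff a₁, pauliSign_mul_of_iff a₂,
        pauliSign_mul_of_not_iff b₁, pauliSign_mul_of_not_iff b₂⟩
    have hplus : s₀ * s₁ * s₂ * s₃ * τ * τ' = c := by
      rcases hor k₁ k₂ hk with h | h
      · simpa [a₁] using hsign k₁ h
      · simpa [a₂] using hsign k₂ h
    have hminus : -(s₀ * s₁ * s₂ * s₃ * τ * τ') = c := by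
      rcases hor l₁ l₂ hl with h | h
      · simpa [b₁] using hsign l₁ h
      · simpa [b₂] using hsign l₂ h
    apply hc
    linear_combination (-1 / 2) * hplus - (1 / 2) * hminus
  subst hww
  refine ⟨w, ![s₀, s₁, s₂, s₃], fun i => ?_⟩
  fin_cases i
  exacts [e₀, e₁, e₂, e₃]

end Stabilizer

/-! ### Comparing Bloch vectors under a mixture of Pauli conjugations. -/

section BlochVectors

/-- Over the integers, identities between signs are finite checks for `decide`. -/
theorem pauliSign_eq_intCast (w k : Fin 4) :
    pauliSign w k = ((if w = 0 ∨ k = 0 ∨ w = k then 1 else -1 : ℤ) : ℝ) := by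
  unfold pauliSign
  split_ifs <;> simp

theorem pauliSign_mul_self (w k : Fin 4) : pauliSign w k * pauliSign w k = 1 := by
  unfold pauliSign
  split_ifs <;> norm_num

theorem pauliSign_mul {u v t : Fin 4} (w : Fin 4) (hu : u ≠ 0) (hv : v ≠ 0) (ht : t ≠ 0)
    (huv : u ≠ v) (hut : u ≠ t) (hvt : v ≠ t) :
    pauliSign w u * pauliSign w v = pauliSign w t := by
  have h : ∀ u v t w : Fin 4, u ≠ 0 → v ≠ 0 → t ≠ 0 → u ≠ v → u ≠ t → v ≠ t →
      (if w = 0 ∨ u = 0 ∨ w = u then 1 else -1 : ℤ) * (if w = 0 ∨ v = 0 ∨ w = v then 1 else -1)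
        = if w = 0 ∨ t = 0 ∨ w = t then 1 else -1 := by decide
  simp only [pauliSign_eq_intCast]
  exact_mod_cast h u v t w hu hv ht huv hut hvt

theorem pauliSign_zero_right (w : Fin 4) : pauliSign w 0 = 1 := by simp [pauliSign]

/-- A weighted mean of signs ±1 has modulus 1 only if the signs agree on the whole support of the
weights, so any `w` in the support serves for all labels at once. -/
theorem exists_pauliSign_eq_of_sq {Q : Fin 4 → ℝ} (hQ : ∀ w, 0 ≤ Q w) (hsum : ∑ w, Q w = 1)
    {act : Fin 4 → Prop}
    (h : ∀ u, u ≠ 0 → act u → (∑ w, Q w * pauliSign w u) ^ 2 = 1) :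
    ∃ w, ∀ u, u ≠ 0 → act u → ∑ x, Q x * pauliSign x u = pauliSign w u := by
  obtain ⟨w, hw⟩ : ∃ w, Q w ≠ 0 := by
    by_contra! hc
    simp [hc] at hsum
  refine ⟨w, fun u hu ha => ?_⟩
  have hsq : ∀ x, pauliSign x u * pauliSign x u = 1 := fun x => pauliSign_mul_self x u
  set ε := ∑ x, Q x * pauliSign x u with hε
  have hε2 : ε ^ 2 = 1 := h u hu ha
  have hzero : ∑ x, Q x * (1 - ε * pauliSign x u) = 0 := by
    have : ∑ x, Q x * (1 - ε * pauliSign x u)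
        = ∑ x, Q x - ε * ∑ x, Q x * pauliSign x u := by
      rw [Finset.mul_sum, ← Finset.sum_sub_distrib]
      exact Finset.sum_congr rfl fun x _ => by ring
    rw [this, hsum, ← hε, ← sq, hε2, sub_self]
  have hterm := (Finset.sum_eq_zero_iff_of_nonneg fun x _ => mul_nonneg (hQ x) (by
    nlinarith [sq_nonneg (ε - pauliSign x u), hsq x])).mp hzero w (Finset.mem_univ w)
  rcases mul_eq_zero.mp hterm with h | h
  · exact absurd h hw
  · linear_combination -ε * hsq w - pauliSign w u * h

/-- The comparison of the Bloch vectors of two product operators of which one is a mixture of the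
Pauli conjugates of the other: the operators are Pauli conjugates of each other, or all but one of
the Bloch vectors point along a common axis. -/
theorem pauliConj_or_axis {g h : Fin 4 → Fin 4 → ℂ} (g0 : ∀ i, g i 0 = 1) (h0 : ∀ i, h i 0 = 1)
    {Q : Fin 4 → ℝ} (hQ : ∀ w, 0 ≤ Q w) (hsum : ∑ w, Q w = 1)
    (hrel : ∀ μ : Fin 4 → Fin 4, ∏ i, g i (μ i) =
      (∑ w, Q w * ∏ i, pauliSign w (μ i) : ℝ) * ∏ i, h i (μ i)) :
    (∃ w, ∀ i u, g i u = pauliSign w u * h i u) ∨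
      ∃ k v, v ≠ 0 ∧ ∀ i, i ≠ k → ∀ u, u ≠ 0 → u ≠ v → g i u = 0 ∧ h i u = 0 := by
  set η : Fin 4 → ℝ := fun u => ∑ w, Q w * pauliSign w u with hη
  have one : ∀ i u, g i u = η u * h i u := by
    intro i u
    have := hrel (Function.update (0 : Fin 4 → Fin 4) i u)
    rw [Fintype.prod_eq_single i fun j hj => by rw [Function.update_of_ne hj]; exact g0 j,
      Fintype.prod_eq_single i fun j hj => by rw [Function.update_of_ne hj]; exact h0 j] at this
    simp only [Function.update_self] at this
    rw [this]
    congr 2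
    refine Finset.sum_congr rfl fun w _ => ?_
    rw [Fintype.prod_eq_single i fun j hj => by
      rw [Function.update_of_ne hj]; exact pauliSign_zero_right w, Function.update_self]
  have two : ∀ i j, i ≠ j → ∀ u v, g i u * g j v =
      (∑ w, Q w * (pauliSign w u * pauliSign w v) : ℝ) * (h i u * h j v) := by
    intro i j hij u v
    have := hrel (Function.update (Function.update (0 : Fin 4 → Fin 4) i u) j v)
    have hp : ∀ {M : Type} [CommMonoid M] (f : Fin 4 → Fin 4 → M), (∀ l, f l 0 = 1) →
        ∏ l, f l (Function.update (Function.update (0 : Fin 4 → Fin 4) i u) j v l) = f i u * f j v := by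
      intro M _ f hf
      rw [Fintype.prod_eq_mul i j hij fun l hl => by
        rw [Function.update_of_ne hl.2, Function.update_of_ne hl.1]; exact hf l]
      simp [Function.update_of_ne hij]
    rw [hp g g0, hp h h0] at this
    rw [this]
    congr 2
    exact Finset.sum_congr rfl fun w _ => by
      rw [hp (fun _ => pauliSign w) fun _ => pauliSign_zero_right w]
  have three : ∀ i j k, i ≠ j → i ≠ k → j ≠ k → ∀ u v t, g i u * g j v * g k t =
      (∑ w, Q w * (pauliSign w u * pauliSign w v * pauliSign w t) : ℝ) *
        (h i u * h j v * h k t) := by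
    intro i j k hij hik hjk u v t
    have := hrel (Function.update (Function.update (Function.update (0 : Fin 4 → Fin 4) i u) j v) k t)
    have hp : ∀ {M : Type} [CommMonoid M] (f : Fin 4 → Fin 4 → M), (∀ l, f l 0 = 1) →
        ∏ l, f l (Function.update (Function.update (Function.update (0 : Fin 4 → Fin 4) i u) j v) k t l)
          = f i u * f j v * f k t := by
      intro M _ f hf
      rw [← Finset.prod_subset (Finset.subset_univ {i, j, k})]
      · rw [Finset.prod_insert (by simp [hij, hik]), Finset.prod_pair hjk, mul_assoc]
        simp [hij, hik, hjk]
      · intro l _ hl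
        simp only [Finset.mem_insert, Finset.mem_singleton, not_or] at hl
        rw [Function.update_of_ne hl.2.2, Function.update_of_ne hl.2.1,
          Function.update_of_ne hl.1]
        exact hf l
    rw [hp g g0, hp h h0] at this
    rw [this]
    congr 2
    exact Finset.sum_congr rfl fun w _ => by
      rw [hp (fun _ => pauliSign w) fun _ => pauliSign_zero_right w]
  have axis : ∀ k v, v ≠ 0 → (∀ i, i ≠ k → ∀ u, u ≠ 0 → u ≠ v → h i u = 0) →
      ∃ k v, v ≠ 0 ∧ ∀ i, i ≠ k → ∀ u, u ≠ 0 → u ≠ v → g i u = 0 ∧ h i u = 0 :=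
    fun k v hv H => ⟨k, v, hv, fun i hi u hu huv =>
      ⟨by rw [one, H i hi u hu huv, mul_zero], H i hi u hu huv⟩⟩
  by_cases hcase : ∃ u, u ≠ 0 ∧ (∃ i, h i u ≠ 0) ∧ η u ^ 2 ≠ 1
  · right
    obtain ⟨u, hu, ⟨i, hi⟩, hηu⟩ := hcase
    -- With the same label at two parties the signs cancel, so the pair correlation is unchanged
    -- although each component is multiplied by `η w`.
    have same : ∀ w, η w ^ 2 ≠ 1 → ∀ i j, i ≠ j → h i w ≠ 0 → h j w = 0 := by
      intro w hw i j hij hiw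
      have h2 := two i j hij w w
      simp only [pauliSign_mul_self, mul_one, hsum, Complex.ofReal_one, one_mul] at h2
      rw [one, one] at h2
      by_contra hjw
      apply hw
      have : ((η w : ℂ) ^ 2 - 1) * (h i w * h j w) = 0 := by linear_combination h2
      rcases mul_eq_zero.mp this with h | h
      · have h' : (η w : ℂ) ^ 2 = 1 := by linear_combination h
        exact_mod_cast h'
      · exact absurd h (mul_ne_zero hiw hjw)
    obtain ⟨v, t, hv, ht, huv, hut, hvt, hall⟩ : ∃ v t : Fin 4, v ≠ 0 ∧ t ≠ 0 ∧ u ≠ v ∧ u ≠ t ∧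
        v ≠ t ∧ ∀ x, x = 0 ∨ x = u ∨ x = v ∨ x = t := by
      clear hηu hi same
      revert u
      decide
    -- Two different Pauli labels multiply to the third one, and so do their signs.
    have diff : ∀ i j, i ≠ j → ∀ u v t : Fin 4, u ≠ 0 → v ≠ 0 → t ≠ 0 → u ≠ v → u ≠ t → v ≠ t →
        h i u ≠ 0 → h j v ≠ 0 → η u * η v = η t := by
      intro i j hij u v t hu hv ht huv hut hvt hiu hjv
      have h2 := two i j hij u v
      simp only [fun w => pauliSign_mul w hu hv ht huv hut hvt] at h2
      rw [one, one] at h2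
      have h3 : (η u : ℂ) * η v = η t := by
        apply mul_right_cancel₀ (mul_ne_zero hiu hjv)
        linear_combination h2
      exact_mod_cast h3
    by_cases hT : ∀ j, j ≠ i → h j t = 0
    · refine axis i v hv fun j hj x hx hxv => ?_
      rcases hall x with rfl | rfl | rfl | rfl
      · exact absurd rfl hx
      · exact same _ hηu i j hj.symm hi
      · exact absurd rfl hxv
      · exact hT j hj
    by_cases hV : ∀ j, j ≠ i → h j v = 0
    · refine axis i t ht fun j hj x hx hxv => ?_
      rcases hall x with rfl | rfl | rfl | rfl
      · exact absurd rfl hx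
      · exact same _ hηu i j hj.symm hi
      · exact hV j hj
      · exact absurd rfl hxv
    push Not at hT hV
    obtain ⟨k, hki, hk⟩ := hT
    obtain ⟨j, hji, hj⟩ := hV
    have d1 := diff i j hji.symm u v t hu hv ht huv hut hvt hi hj
    have d2 := diff i k hki.symm u t v hu ht hv hut huv hvt.symm hi hk
    have hv0 : η v = 0 := by
      have : (η u ^ 2 - 1) * η v = 0 := by rw [← d1] at d2; linear_combination d2
      rcases mul_eq_zero.mp this with h | h
      · exact absurd (by linear_combination h) hηu
      · exact h
    have ht0 : η t = 0 := by rw [← d1, hv0, mul_zero]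
    -- With u, v, t at three distinct parties the signs multiply to 1, so the triple correlation
    -- would be unchanged, yet `η v = 0` kills it.
    have hjk : j = k := by
      by_contra hjk
      have h3 := three i j k hji.symm hki.symm hjk u v t
      simp only [fun w => pauliSign_mul w hu hv ht huv hut hvt, pauliSign_mul_self, mul_one, hsum,
        Complex.ofReal_one, one_mul] at h3
      rw [one j v, hv0] at h3
      apply mul_ne_zero (mul_ne_zero hi hj) hk
      rw [← h3]; simp
    subst hjk
    refine axis j u hu fun l hl x hx hxu => ?_
    rcases hall x with rfl | rfl | rfl | rfl
    · exact absurd rfl hx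
    · exact absurd rfl hxu
    · exact same _ (by rw [hv0]; norm_num) j l hl.symm hj
    · exact same _ (by rw [ht0]; norm_num) j l hl.symm hk
  · left
    push Not at hcase
    obtain ⟨w, hw⟩ := exists_pauliSign_eq_of_sq hQ hsum (act := fun u => ∃ i, h i u ≠ 0)
      fun u hu ha => hcase u hu ha
    refine ⟨w, fun i u => ?_⟩
    rw [one]
    by_cases hu : u = 0
    · subst hu
      simp [hη, pauliSign_zero_right, hsum]
    by_cases hz : h i u = 0
    · rw [hz, mul_zero, mul_zero]
    · rw [← hw u hu ⟨i, hz⟩]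

end BlochVectors

/-! ### Recognising the axis form from the Gram matrix. -/

section Axis

theorem AlongAxis.exists_conjTranspose_mul_self {w : Fin 3} {A : Matrix (Fin 2) (Fin 2) ℂ}
    (h : AlongAxis w A) : ∃ (U : Matrix (Fin 2) (Fin 2) ℂ) (s t : ℂ),
      U ∈ Matrix.unitaryGroup (Fin 2) ℂ ∧ A = U * (s • 1 + t • pauliBasis w.succ) := by
  obtain ⟨U, hU, B, hB, rfl⟩ := h
  obtain ⟨s, t, rfl⟩ := Submodule.mem_span_pair.mp hB
  exact ⟨U, s, t, hU, by rw [pauliBasis_succ]⟩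

open scoped ComplexOrder in
theorem trace_re_pos {A : Matrix (Fin 2) (Fin 2) ℂ} (hA : A.det ≠ 0) :
    ∃ r : ℝ, 0 < r ∧ (A.conjTranspose * A).trace = r := by
  have hr : (A.conjTranspose * A).trace =
      ((Complex.normSq (A 0 0) + Complex.normSq (A 1 0) + Complex.normSq (A 0 1) +
        Complex.normSq (A 1 1) : ℝ) : ℂ) := by
    simp only [Matrix.trace_fin_two, Matrix.mul_apply, Fin.sum_univ_two,
      Matrix.conjTranspose_apply, Complex.ofReal_add, Complex.normSq_eq_conj_mul_self]
    simp only [RCLike.star_def]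
    ring
  refine ⟨_, ?_, hr⟩
  have hne : (A.conjTranspose * A).trace ≠ 0 := by
    rw [Ne, Matrix.trace_conjTranspose_mul_self_eq_zero_iff]
    rintro rfl
    exact hA (by simp)
  rw [hr] at hne
  refine lt_of_le_of_ne ?_ fun h => hne (by rw [← h, Complex.ofReal_zero])
  exact add_nonneg (add_nonneg (add_nonneg (Complex.normSq_nonneg _) (Complex.normSq_nonneg _))
    (Complex.normSq_nonneg _)) (Complex.normSq_nonneg _)

theorem trace_pauliBasis_conjTranspose_mul_self (A : Matrix (Fin 2) (Fin 2) ℂ) (u : Fin 4) :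
    ∃ r : ℝ, (pauliBasis u * (A.conjTranspose * A)).trace = r := by
  refine ⟨_, (Complex.conj_eq_iff_re.mp ?_).symm⟩
  rw [← RCLike.star_def, ← Matrix.trace_conjTranspose, Matrix.conjTranspose_mul,
    Matrix.conjTranspose_mul, Matrix.conjTranspose_conjTranspose, pauliBasis_conjTranspose,
    Matrix.trace_mul_comm]

theorem smul_add_smul_pauliBasis_mul (w : Fin 4) (s t s' t' : ℂ) :
    (s • 1 + t • pauliBasis w) * (s' • 1 + t' • pauliBasis w) =
      (s * s' + t * t') • (1 : Matrix (Fin 2) (Fin 2) ℂ) + (s * t' + t * s') • pauliBasis w := by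
  simp only [Matrix.add_mul, Matrix.mul_add, Matrix.smul_mul, Matrix.mul_smul, Matrix.one_mul,
    Matrix.mul_one, pauliBasis_mul_self]
  module

/-- This is the polar decomposition. The Gram matrix lies in the span of 1 and σ and has positive
eigenvalues (a ± b)/2, so its positive square root `B` lies in the same span, and `A * B⁻¹` is
unitary. -/
theorem alongAxis_of_trace_eq_zero {A : Matrix (Fin 2) (Fin 2) ℂ} (hA : A.det ≠ 0) {w : Fin 3}
    (h : ∀ u, u ≠ 0 → u ≠ w.succ → (pauliBasis u * (A.conjTranspose * A)).trace = 0) :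
    AlongAxis w A := by
  obtain ⟨a, ha, hta⟩ := trace_re_pos hA
  obtain ⟨b, hb⟩ := trace_pauliBasis_conjTranspose_mul_self A w.succ
  have hw0 : w.succ ≠ 0 := Fin.succ_ne_zero w
  have hG : A.conjTranspose * A = ((a / 2 : ℝ) : ℂ) • 1 + ((b / 2 : ℝ) : ℂ) • pauliBasis w.succ := by
    have hsum := sum_trace_pauliBasis (A.conjTranspose * A)
    rw [Fintype.sum_eq_add 0 w.succ hw0.symm fun u hu => by rw [h u hu.1 hu.2, zero_smul], hb] at hsum
    have h1 : pauliBasis 0 = 1 := rfl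
    rw [h1, Matrix.one_mul, hta] at hsum
    rw [hsum, smul_add, smul_smul, smul_smul]
    push_cast
    congr 2 <;> ring
  have hdetG : (A.conjTranspose * A).det = ((Complex.normSq A.det : ℝ) : ℂ) := by
    rw [Matrix.det_mul, Matrix.det_conjTranspose, Complex.normSq_eq_conj_mul_self]
    rfl
  have hdet2 : (A.conjTranspose * A).det = ((a ^ 2 / 4 - b ^ 2 / 4 : ℝ) : ℂ) := by
    rw [hG, Matrix.det_fin_two]
    push_cast
    fin_cases w <;> (simp [pauliBasis]; ring_nf; try simp [Complex.I_sq]; try ring)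
  have hpos : 0 < a ^ 2 / 4 - b ^ 2 / 4 := by
    have : Complex.normSq A.det = a ^ 2 / 4 - b ^ 2 / 4 := by
      exact_mod_cast hdetG.symm.trans hdet2
    rw [← this]
    exact Complex.normSq_pos.mpr hA
  have hp : 0 ≤ (a + b) / 2 := by nlinarith
  have hm : 0 ≤ (a - b) / 2 := by nlinarith
  have sp := Real.mul_self_sqrt hp
  have sm := Real.mul_self_sqrt hm
  set x := √((a + b) / 2)
  set y := √((a - b) / 2)
  set B : Matrix (Fin 2) (Fin 2) ℂ :=
    (((x + y) / 2 : ℝ) : ℂ) • 1 + (((x - y) / 2 : ℝ) : ℂ) • pauliBasis w.succ with hBdef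
  have hBB : B * B = A.conjTranspose * A := by
    rw [hBdef, smul_add_smul_pauliBasis_mul, hG]
    norm_cast
    congr 3 <;> linarith
  have hBstar : B.conjTranspose = B := by
    rw [hBdef, Matrix.conjTranspose_add, Matrix.conjTranspose_smul, Matrix.conjTranspose_smul,
      pauliBasis_conjTranspose, Matrix.conjTranspose_one]
    simp [-Complex.ofReal_div, -Complex.ofReal_add, -Complex.ofReal_sub]
  have hBdet : IsUnit B.det := by
    rw [isUnit_iff_ne_zero]
    intro h0
    have := congrArg Matrix.det hBB
    rw [Matrix.det_mul, h0, zero_mul, Matrix.det_mul, Matrix.det_conjTranspose] at this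
    rcases mul_eq_zero.mp this.symm with h | h
    · exact hA (star_eq_zero.mp h)
    · exact hA h
  refine ⟨A * B⁻¹, ?_, B, ?_, ?_⟩
  · rw [Matrix.mem_unitaryGroup_iff', Matrix.star_eq_conjTranspose, Matrix.conjTranspose_mul,
      Matrix.conjTranspose_nonsing_inv, hBstar, Matrix.mul_assoc, ← Matrix.mul_assoc _ A, ← hBB,
      Matrix.mul_assoc, Matrix.mul_nonsing_inv _ hBdet, Matrix.mul_one,
      Matrix.nonsing_inv_mul _ hBdet]
  · rw [← pauliBasis_succ]
    exact Submodule.mem_span_pair.mpr ⟨_, _, rfl⟩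
  · rw [Matrix.mul_assoc, Matrix.nonsing_inv_mul _ hBdet, Matrix.mul_one]

end Axis

/-! ### Conversions between generic states: LU-equivalence or axis form. -/

section Conversion

theorem genericState_fullyEntangled {p : Fin 4 → ℂ} (hp : GenericSeed p)
    (g : Fin 4 → GL (Fin 2) ℂ) : FullyEntangled (genericState p g) :=
  hp.fullyEntangled.localApply fun i => (g i).det_ne_zero

theorem exists_genericState {p : Fin 4 → ℂ} {A : Fin 4 → Matrix (Fin 2) (Fin 2) ℂ}
    (hA : ∀ i, (A i).det ≠ 0) {c : ℂ} (hc : c ≠ 0) :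
    ∃ h : Fin 4 → GL (Fin 2) ℂ,
      c • localApply (d := fun _ => 2) (e := fun _ => 2) A (seed p) = genericState p h := by
  let C : Fin 4 → ℂ := ![c, 1, 1, 1]
  have hC : ∀ i, C i ≠ 0 := by
    intro i; fin_cases i <;> simp [C, hc]
  refine ⟨fun i => Matrix.GeneralLinearGroup.mkOfDetNeZero (C i • A i) ?_, ?_⟩
  · rw [Matrix.det_smul]
    exact mul_ne_zero (pow_ne_zero _ (hC i)) (hA i)
  · have := localApply_smul (d := fun _ => 2) (e := fun _ => 2) C A (seed p)
    have hprod : ∏ i, C i = c := by simp [C, Fin.prod_univ_four]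
    rw [hprod] at this
    exact this.symm

theorem LOCCConvertible.exists_localApply {ψ φ : FourQubit} (hψ : ψ ≠ 0)
    (hφ : FullyEntangled φ) (h : LOCCConvertible ψ φ) :
    ∃ (A : Fin 4 → Matrix (Fin 2) (Fin 2) ℂ) (c : ℂ), (∀ i, (A i).det ≠ 0) ∧ c ≠ 0 ∧
      φ = c • localApply (d := fun _ => 2) (e := fun _ => 2) A ψ := by
  obtain ⟨A, c, hc, hA⟩ := LOCCTo.exists_localApply h hψ
  have hFE := hφ.smul hc
  rw [← hA] at hFE
  exact ⟨A, c⁻¹, det_ne_zero_of_fullyEntangled_localApply hFE, inv_ne_zero hc, by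
    rw [hA, smul_smul, inv_mul_cancel₀ hc, one_smul]⟩

theorem exists_genericState_of_convertible_from {p : Fin 4 → ℂ} (hp : GenericSeed p)
    (g : Fin 4 → GL (Fin 2) ℂ) {φ : FourQubit} (hφ : FullyEntangled φ)
    (h : LOCCConvertible (genericState p g) φ) : ∃ h, φ = genericState p h := by
  obtain ⟨A, c, hA, hc, rfl⟩ := h.exists_localApply (genericState_fullyEntangled hp g).ne_zero hφ
  obtain ⟨h, hh⟩ := exists_genericState (p := p)
    (A := fun i => A i * (g i : Matrix (Fin 2) (Fin 2) ℂ))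
    (fun i => by rw [Matrix.det_mul]; exact mul_ne_zero (hA i) (g i).det_ne_zero) hc
  exact ⟨h, by rw [← hh, genericState, localApply_localApply]⟩

theorem exists_genericState_of_convertible_to {p : Fin 4 → ℂ} (hp : GenericSeed p)
    (g : Fin 4 → GL (Fin 2) ℂ) {φ : FourQubit} (hφ : FullyEntangled φ)
    (h : LOCCConvertible φ (genericState p g)) : ∃ h, φ = genericState p h := by
  obtain ⟨A, c, hA, hc, hg⟩ := h.exists_localApply hφ.ne_zero (genericState_fullyEntangled hp g)
  obtain ⟨h, hh⟩ := exists_genericState (p := p)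
    (A := fun i => (A i)⁻¹ * (g i : Matrix (Fin 2) (Fin 2) ℂ))
    (fun i => by
      rw [Matrix.det_mul, Matrix.det_nonsing_inv, Ring.inverse_eq_inv']
      exact mul_ne_zero (inv_ne_zero (hA i)) (g i).det_ne_zero) (inv_ne_zero hc)
  refine ⟨h, ?_⟩
  rw [← hh, ← localApply_localApply (d := fun _ => 2) (e := fun _ => 2), ← genericState, hg,
    localApply_smul_right, smul_smul, inv_mul_cancel₀ hc, one_smul,
    localApply_eq_of_left_inverse (d := fun _ => 2) (e := fun _ => 2)
      fun i => Matrix.nonsing_inv_mul _ (isUnit_iff_ne_zero.mpr (hA i))]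

/-- The Gram operator of the source of a conversion is a mixture of the Pauli conjugates of the
Gram operator of the target. -/
theorem LOCCConvertible.exists_pauli_mixture {p : Fin 4 → ℂ} (hp : GenericSeed p)
    {g h : Fin 4 → GL (Fin 2) ℂ} (hconv : LOCCConvertible (genericState p g) (genericState p h)) :
    ∃ P : Fin 4 → ℝ, (∀ w, 0 ≤ P w) ∧
      piKron (d := fun _ => 2) (e := fun _ => 2)
          (fun i => (g i : Matrix (Fin 2) (Fin 2) ℂ).conjTranspose * g i) =
        ∑ w, (P w : ℂ) • piKron (d := fun _ => 2) (e := fun _ => 2) (fun i => pauliBasis w *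
          ((h i : Matrix (Fin 2) (Fin 2) ℂ).conjTranspose * h i) * pauliBasis w) := by
  obtain ⟨ι, _, A, hA, hsum⟩ := LOCCTo.exists_kraus (genericState_fullyEntangled hp h)
    hp.fullyEntangled hconv (fun i => (g i : Matrix (Fin 2) (Fin 2) ℂ))
    (fun i => ⟨((g i)⁻¹ : GL (Fin 2) ℂ), by rw [← Units.val_mul, inv_mul_cancel, Units.val_one]⟩)
    rfl
  have hst : ∀ j, ∃ (w : Fin 4) (s : Fin 4 → ℂ), ∀ i,
      A j i = s i • ((h i : Matrix (Fin 2) (Fin 2) ℂ) * pauliBasis w) := by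
    intro j
    obtain ⟨c, hc, hj⟩ := hA j
    have hS : localApply (d := fun _ => 2) (e := fun _ => 2)
        (fun i => (((h i)⁻¹ : GL (Fin 2) ℂ) : Matrix (Fin 2) (Fin 2) ℂ) * A j i) (seed p)
        = c • seed p := by
      rw [← localApply_localApply (d := fun _ => 2) (e := fun _ => 2), hj, localApply_smul_right,
        genericState, localApply_eq_of_left_inverse (d := fun _ => 2) (e := fun _ => 2)]
      intro i
      rw [← Units.val_mul, inv_mul_cancel, Units.val_one]
    obtain ⟨w, s, hs⟩ := hp.stabilizer hc hS
    refine ⟨w, s, fun i => ?_⟩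
    rw [← Matrix.mul_smul, ← hs i, ← Matrix.mul_assoc, ← Units.val_mul, mul_inv_cancel,
      Units.val_one, Matrix.one_mul]
  choose w s hs using hst
  -- The weight of σ_v collects the squared moduli of the scalars of all branches whose symmetry is
  -- σ_v.
  refine ⟨fun v => ∑ j with w j = v, Complex.normSq (∏ i, s j i), fun v =>
    Finset.sum_nonneg fun j _ => Complex.normSq_nonneg _, ?_⟩
  rw [← hsum, ← Finset.sum_fiberwise Finset.univ w]
  refine Finset.sum_congr rfl fun v _ => ?_
  push_cast
  rw [Finset.sum_smul]
  refine Finset.sum_congr rfl fun j hj => ?_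
  obtain rfl : w j = v := (Finset.mem_filter.mp hj).2
  have : (fun i => (A j i).conjTranspose * A j i) = fun i => (starRingEnd ℂ (s j i) * s j i) •
      (pauliBasis (w j) * ((h i : Matrix (Fin 2) (Fin 2) ℂ).conjTranspose * h i) *
        pauliBasis (w j)) := by
    funext i
    rw [hs, Matrix.conjTranspose_smul, Matrix.conjTranspose_mul, pauliBasis_conjTranspose,
      Matrix.smul_mul, Matrix.mul_smul, smul_smul]
    simp only [Matrix.mul_assoc, RCLike.star_def]
  rw [this, piKron_smul, Finset.prod_mul_distrib, ← map_prod, Complex.normSq_eq_conj_mul_self]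

/-- The coordinates of the Bloch vector of an unnormalised operator. -/
noncomputable def bloch (M : Matrix (Fin 2) (Fin 2) ℂ) (u : Fin 4) : ℂ :=
  (pauliBasis u * M).trace / M.trace

theorem bloch_zero {M : Matrix (Fin 2) (Fin 2) ℂ} (h : M.trace ≠ 0) : bloch M 0 = 1 := by
  have h1 : pauliBasis 0 = 1 := rfl
  rw [bloch, h1, Matrix.one_mul, div_self h]

theorem trace_gram_ne_zero (g : GL (Fin 2) ℂ) :
    ((g : Matrix (Fin 2) (Fin 2) ℂ).conjTranspose * g).trace ≠ 0 := by
  obtain ⟨r, hr, h⟩ := trace_re_pos g.det_ne_zero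
  rw [h]
  exact_mod_cast hr.ne'

/-- Tracing against tensor products of Pauli matrices compares the coefficients; the label `μ = 0`
yields the normalisation that turns `P` into a probability distribution. -/
theorem prod_bloch_eq {G H : Fin 4 → Matrix (Fin 2) (Fin 2) ℂ} (hG : ∀ i, (G i).trace ≠ 0)
    (hH : ∀ i, (H i).trace ≠ 0) {P : Fin 4 → ℝ} (hP : ∀ w, 0 ≤ P w)
    (h : piKron (d := fun _ => 2) (e := fun _ => 2) G =
      ∑ w, (P w : ℂ) • piKron (d := fun _ => 2) (e := fun _ => 2)
        (fun i => pauliBasis w * H i * pauliBasis w)) :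
    ∃ Q : Fin 4 → ℝ, (∀ w, 0 ≤ Q w) ∧ ∑ w, Q w = 1 ∧ ∀ μ : Fin 4 → Fin 4,
      ∏ i, bloch (G i) (μ i) =
        (∑ w, Q w * ∏ i, pauliSign w (μ i) : ℝ) * ∏ i, bloch (H i) (μ i) := by
  have key : ∀ μ : Fin 4 → Fin 4, ∏ i, (pauliBasis (μ i) * G i).trace =
      (∑ w, P w * ∏ i, pauliSign w (μ i) : ℝ) * ∏ i, (pauliBasis (μ i) * H i).trace := by
    intro μ
    rw [← trace_piKron (d := fun _ => 2), piKron_mul, h, Matrix.mul_sum, Matrix.trace_sum]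
    push_cast
    rw [Finset.sum_mul]
    refine Finset.sum_congr rfl fun w _ => ?_
    rw [Matrix.mul_smul, ← piKron_mul, Matrix.trace_smul, trace_piKron, smul_eq_mul, mul_assoc,
      ← Finset.prod_mul_distrib]
    simp only [trace_pauliBasis_conj]
  have h1 : pauliBasis 0 = 1 := rfl
  have k0 := key 0
  simp only [Pi.zero_apply, h1, Matrix.one_mul, pauliSign_zero_right, Finset.prod_const_one,
    mul_one] at k0
  have hS : (∑ w, P w) ≠ 0 := by
    intro h0
    rw [h0, Complex.ofReal_zero, zero_mul] at k0
    exact Finset.prod_ne_zero_iff.mpr (fun i _ => hG i) k0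
  refine ⟨fun w => P w / ∑ x, P x, fun w => div_nonneg (hP w) (Finset.sum_nonneg fun x _ => hP x),
    by rw [← Finset.sum_div, div_self hS], fun μ => ?_⟩
  simp only [bloch, Finset.prod_div_distrib]
  rw [key μ, k0]
  have e : ∑ w, P w / (∑ x, P x) * ∏ i, pauliSign w (μ i)
      = (∑ w, P w * ∏ i, pauliSign w (μ i)) / ∑ x, P x := by
    rw [Finset.sum_div]
    exact Finset.sum_congr rfl fun w _ => by ring
  rw [e, Complex.ofReal_div]
  have hS' : ((∑ x, P x : ℝ) : ℂ) ≠ 0 := by exact_mod_cast hS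
  have hH' : ∏ i, (H i).trace ≠ 0 := Finset.prod_ne_zero_iff.mpr fun i _ => hH i
  field_simp

/-- Up to the ratio of traces, gᵢ†gᵢ equals σ hᵢ†hᵢ σ, so a multiple of hᵢ σ gᵢ⁻¹ is unitary. These
unitaries map g|Ψ⟩ to h σ⊗σ⊗σ⊗σ|Ψ⟩ up to a factor, and the seed absorbs the Pauli matrices. -/
theorem luEquivalent_of_bloch {p : Fin 4 → ℂ} {g h : Fin 4 → GL (Fin 2) ℂ} {w : Fin 4}
    (H : ∀ i u, bloch ((g i : Matrix (Fin 2) (Fin 2) ℂ).conjTranspose * g i) u =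
      pauliSign w u * bloch ((h i : Matrix (Fin 2) (Fin 2) ℂ).conjTranspose * h i) u) :
    LUEquivalent (genericState p g) (genericState p h) := by
  have key : ∀ i, ∃ c : ℂ, c ≠ 0 ∧ c • ((h i : Matrix (Fin 2) (Fin 2) ℂ) * pauliBasis w *
      ((g i)⁻¹ : GL (Fin 2) ℂ)) ∈ Matrix.unitaryGroup (Fin 2) ℂ := by
    intro i
    obtain ⟨a, ha, hta⟩ := trace_re_pos (g i).det_ne_zero
    obtain ⟨b, hb, htb⟩ := trace_re_pos (h i).det_ne_zero
    have hab : (0 : ℝ) ≤ a / b := (div_pos ha hb).le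
    set G := (g i : Matrix (Fin 2) (Fin 2) ℂ).conjTranspose * g i with hGdef
    set K := (h i : Matrix (Fin 2) (Fin 2) ℂ).conjTranspose * h i with hKdef
    have hG : G = ((a / b : ℝ) : ℂ) • (pauliBasis w * K * pauliBasis w) := by
      rw [sum_trace_pauliBasis G, sum_trace_pauliBasis (pauliBasis w * K * pauliBasis w),
        smul_comm]
      refine congrArg (fun M : Matrix (Fin 2) (Fin 2) ℂ => (1 / 2 : ℂ) • M) 
        ((Finset.sum_congr rfl fun u _ => ?_).trans Finset.smul_sum.symm)
      rw [smul_smul, trace_pauliBasis_conj]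
      congr 1
      have hu := H i u
      rw [← hGdef, ← hKdef, bloch, bloch, hta, htb] at hu
      have ha' : (a : ℂ) ≠ 0 := by exact_mod_cast ha.ne'
      have hb' : (b : ℂ) ≠ 0 := by exact_mod_cast hb.ne'
      rw [div_eq_iff ha'] at hu
      rw [hu]
      push_cast
      field_simp
    refine ⟨((√(a / b) : ℝ) : ℂ), ?_, ?_⟩
    · have := Real.sqrt_pos.mpr (div_pos ha hb)
      exact_mod_cast this.ne'
    · have hgg : (g i : Matrix (Fin 2) (Fin 2) ℂ) * ((g i)⁻¹ : GL (Fin 2) ℂ) = 1 := by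
        rw [← Units.val_mul, mul_inv_cancel, Units.val_one]
      rw [Matrix.mem_unitaryGroup_iff', Matrix.star_eq_conjTranspose, Matrix.conjTranspose_smul,
        Matrix.smul_mul, Matrix.mul_smul, smul_smul, RCLike.star_def, Complex.conj_ofReal,
        ← Complex.ofReal_mul, Real.mul_self_sqrt hab, Matrix.conjTranspose_mul,
        Matrix.conjTranspose_mul, pauliBasis_conjTranspose]
      calc _ = (((g i)⁻¹ : GL (Fin 2) ℂ) : Matrix (Fin 2) (Fin 2) ℂ).conjTranspose *
            (((a / b : ℝ) : ℂ) • (pauliBasis w * K * pauliBasis w)) * ((g i)⁻¹ : GL (Fin 2) ℂ) := by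
            simp only [hKdef, Matrix.mul_assoc, Matrix.mul_smul, Matrix.smul_mul]
        _ = ((g i : Matrix (Fin 2) (Fin 2) ℂ) * ((g i)⁻¹ : GL (Fin 2) ℂ)).conjTranspose *
            ((g i : Matrix (Fin 2) (Fin 2) ℂ) * ((g i)⁻¹ : GL (Fin 2) ℂ)) := by
            rw [← hG, hGdef, Matrix.conjTranspose_mul]
            simp only [Matrix.mul_assoc]
        _ = 1 := by rw [hgg, Matrix.conjTranspose_one, Matrix.one_mul]
  choose c hc hU using key
  have hprod : ∏ i, c i ≠ 0 := Finset.prod_ne_zero_iff.mpr fun i _ => hc i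
  refine ⟨fun i => ⟨_, hU i⟩, (∏ i, c i)⁻¹, inv_ne_zero hprod, ?_⟩
  rw [localApply_smul, smul_smul, inv_mul_cancel₀ hprod, one_smul, genericState, genericState,
    localApply_localApply]
  have : ∀ i, (h i : Matrix (Fin 2) (Fin 2) ℂ) * pauliBasis w * ((g i)⁻¹ : GL (Fin 2) ℂ) * g i
      = h i * pauliBasis w := fun i => by
    rw [Matrix.mul_assoc, ← Units.val_mul, inv_mul_cancel, Units.val_one, Matrix.mul_one]
  simp only [this]
  rw [← localApply_localApply (d := fun _ => 2) (e := fun _ => 2), localApply_pauliBasis_seed]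

theorem hasAxisForm_of_bloch {g : Fin 4 → GL (Fin 2) ℂ} {k v : Fin 4} (hv : v ≠ 0)
    (H : ∀ i, i ≠ k → ∀ u, u ≠ 0 → u ≠ v →
      bloch ((g i : Matrix (Fin 2) (Fin 2) ℂ).conjTranspose * g i) u = 0) : HasAxisForm g := by
  obtain ⟨w, rfl⟩ := Fin.exists_succ_eq.mpr hv
  refine ⟨k, w, fun i hi => alongAxis_of_trace_eq_zero (g i).det_ne_zero fun u hu huw => ?_⟩
  exact (div_eq_zero_iff.mp (H i hi u hu huw)).resolve_right (trace_gram_ne_zero (g i))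

/-- A conversion between generic states is trivial, or both states have the axis form. -/
theorem LOCCConvertible.luEquivalent_or_hasAxisForm {p : Fin 4 → ℂ} (hp : GenericSeed p)
    {g h : Fin 4 → GL (Fin 2) ℂ} (hconv : LOCCConvertible (genericState p g) (genericState p h)) :
    (LUEquivalent (genericState p g) (genericState p h) ∧
      LUEquivalent (genericState p h) (genericState p g)) ∨ (HasAxisForm g ∧ HasAxisForm h) := by
  obtain ⟨P, hP, hmix⟩ := hconv.exists_pauli_mixture hp
  obtain ⟨Q, hQ, hQ1, hrel⟩ := prod_bloch_eq (fun i => trace_gram_ne_zero (g i))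
    (fun i => trace_gram_ne_zero (h i)) hP hmix
  rcases pauliConj_or_axis (fun i => bloch_zero (trace_gram_ne_zero (g i)))
    (fun i => bloch_zero (trace_gram_ne_zero (h i))) hQ hQ1 hrel with ⟨w, hw⟩ | ⟨k, v, hv, H⟩
  · refine Or.inl ⟨luEquivalent_of_bloch (w := w) hw, luEquivalent_of_bloch (w := w) fun i u => ?_⟩
    rw [hw i u, ← mul_assoc, ← Complex.ofReal_mul, pauliSign_mul_self, Complex.ofReal_one, one_mul]
  · exact Or.inr ⟨hasAxisForm_of_bloch hv fun i hi u hu huv => (H i hi u hu huv).1,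
      hasAxisForm_of_bloch hv fun i hi u hu huv => (H i hi u hu huv).2⟩

end Conversion

/-! ### An explicit nontrivial conversion from the axis form. -/

section AxisConversion

/-- A positive definite `2 × 2` matrix is a Gram matrix. -/
theorem exists_gram_eq {H : Matrix (Fin 2) (Fin 2) ℂ} (hH : H.conjTranspose = H)
    (h0 : 0 < (H 0 0).re) (hdet : 0 < H.det.re) :
    ∃ h : GL (Fin 2) ℂ, (h : Matrix (Fin 2) (Fin 2) ℂ).conjTranspose * h = H := by
  have e00 : (((H 0 0).re : ℝ) : ℂ) = H 0 0 := by
    have := congrFun (congrFun hH 0) 0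
    exact Complex.conj_eq_iff_re.mp this
  have e11 : (((H 1 1).re : ℝ) : ℂ) = H 1 1 := by
    have := congrFun (congrFun hH 1) 1
    exact Complex.conj_eq_iff_re.mp this
  have e10 : starRingEnd ℂ (H 0 1) = H 1 0 := congrFun (congrFun hH 1) 0
  set a := (H 0 0).re
  set b := (H 1 1).re
  have hd : H.det = ((a * b - Complex.normSq (H 0 1) : ℝ) : ℂ) := by
    rw [Matrix.det_fin_two, ← e10, ← e00, ← e11, Complex.mul_conj]
    push_cast
    ring
  rw [hd, Complex.ofReal_re] at hdet
  have hc : 0 < (a * b - Complex.normSq (H 0 1)) / a := div_pos hdet h0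
  have sa := Real.mul_self_sqrt h0.le
  have sc := Real.mul_self_sqrt hc.le
  have pa := Real.sqrt_pos.mpr h0
  have pc := Real.sqrt_pos.mpr hc
  set x := √a
  set y := √((a * b - Complex.normSq (H 0 1)) / a)
  have hx : (x : ℂ) ≠ 0 := by exact_mod_cast pa.ne'
  have hy : (y : ℂ) ≠ 0 := by exact_mod_cast pc.ne'
  have ha : (a : ℂ) ≠ 0 := by exact_mod_cast h0.ne'
  have sa' : (x : ℂ) * x = a := by exact_mod_cast sa
  have sc' : (y : ℂ) * y = (a * b - H 0 1 * H 1 0) / a := by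
    rw [← e10, Complex.mul_conj]; exact_mod_cast sc
  -- The upper triangular Cholesky factor.
  refine ⟨Matrix.GeneralLinearGroup.mkOfDetNeZero !![(x : ℂ), H 0 1 / x; 0, (y : ℂ)] ?_, ?_⟩
  · rw [Matrix.det_fin_two]
    simp [hx, hy]
  · change (!![(x : ℂ), H 0 1 / x; 0, (y : ℂ)]).conjTranspose * !![(x : ℂ), H 0 1 / x; 0, (y : ℂ)] = H
    ext i j
    fin_cases i <;> fin_cases j <;>
      simp [Matrix.mul_apply, Fin.sum_univ_two, Matrix.conjTranspose_apply]
    · rw [sa', e00]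
    · field_simp
    · rw [e10]; field_simp
    · rw [sc', e10, ← e11, div_mul_div_comm, sa']
      field_simp
      ring

theorem pauliBasis_mul_mul_mul_mul (w : Fin 4) (A B : Matrix (Fin 2) (Fin 2) ℂ) :
    (pauliBasis w * A * pauliBasis w) * (pauliBasis w * B * pauliBasis w) =
      pauliBasis w * (A * B) * pauliBasis w := by
  calc _ = pauliBasis w * A * (pauliBasis w * pauliBasis w) * B * pauliBasis w := by
        simp only [Matrix.mul_assoc]
    _ = _ := by rw [pauliBasis_mul_self]; simp only [Matrix.mul_assoc, Matrix.one_mul]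

theorem trace_pauliBasis_mul_mul (w : Fin 4) (A : Matrix (Fin 2) (Fin 2) ℂ) :
    (pauliBasis w * A * pauliBasis w).trace = A.trace := by
  rw [Matrix.trace_mul_comm, ← Matrix.mul_assoc, pauliBasis_mul_self, Matrix.one_mul]

/-- `D` is the part of `G` that anticommutes with σ, with `κ = 1`. If that part vanishes, any
anticommuting Pauli matrix does, with `κ = 0`. -/
theorem exists_anticommuting {w : Fin 4} (hw : w ≠ 0) (G : Matrix (Fin 2) (Fin 2) ℂ)
    (hG : G.conjTranspose = G) :
    ∃ (D : Matrix (Fin 2) (Fin 2) ℂ) (κ : ℝ), 0 ≤ κ ∧ D ≠ 0 ∧ D.conjTranspose = D ∧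
      pauliBasis w * D * pauliBasis w = -D ∧
      pauliBasis w * G * pauliBasis w = G - (2 * κ : ℂ) • D := by
  have hinv : pauliBasis w * (pauliBasis w * G * pauliBasis w) * pauliBasis w = G := by
    calc _ = (pauliBasis w * pauliBasis w) * G * (pauliBasis w * pauliBasis w) := by
          simp only [Matrix.mul_assoc]
      _ = G := by rw [pauliBasis_mul_self, Matrix.one_mul, Matrix.mul_one]
  by_cases h : pauliBasis w * G * pauliBasis w = G
  · obtain ⟨v, hv⟩ : ∃ v : Fin 4, ¬ (w = 0 ∨ v = 0 ∨ w = v) := by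
      clear hinv h; revert w; decide
    refine ⟨pauliBasis v, 0, le_rfl, pauliBasis_ne_zero v, pauliBasis_conjTranspose v, ?_, ?_⟩
    · rw [pauliBasis_mul_mul, pauliSign, if_neg hv]
      simp
    · rw [h]; simp
  · refine ⟨(1 / 2 : ℂ) • (G - pauliBasis w * G * pauliBasis w), 1, zero_le_one, ?_, ?_, ?_, ?_⟩
    · exact smul_ne_zero (by norm_num) (sub_ne_zero.mpr (Ne.symm h))
    · rw [Matrix.conjTranspose_smul, Matrix.conjTranspose_sub, Matrix.conjTranspose_mul,
        Matrix.conjTranspose_mul, pauliBasis_conjTranspose, hG, ← Matrix.mul_assoc]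
      simp
    · rw [Matrix.mul_smul, Matrix.smul_mul, Matrix.mul_sub, Matrix.sub_mul, hinv, ← smul_neg,
        neg_sub]
    · rw [smul_smul]
      simp

/-- Adding `τ • D` lengthens the anticommuting part from κD to (κ + τ)D and keeps the trace; a small
τ > 0 preserves positivity. Mixing the result with its σ-conjugate shrinks this part back to κD when
the weights sum to 1 and differ by κ/(κ + τ). The trace of the square grows, and this later excludes
LU-equivalence. -/
theorem exists_gram_mixture (g : GL (Fin 2) ℂ) {w : Fin 4} (hw : w ≠ 0) :
    ∃ (h : GL (Fin 2) ℂ) (a b : ℝ), 0 ≤ a ∧ 0 ≤ b ∧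
      ((h : Matrix (Fin 2) (Fin 2) ℂ).conjTranspose * h).trace =
        ((g : Matrix (Fin 2) (Fin 2) ℂ).conjTranspose * g).trace ∧
      (((h : Matrix (Fin 2) (Fin 2) ℂ).conjTranspose * h) *
          ((h : Matrix (Fin 2) (Fin 2) ℂ).conjTranspose * h)).trace ≠
        (((g : Matrix (Fin 2) (Fin 2) ℂ).conjTranspose * g) *
          ((g : Matrix (Fin 2) (Fin 2) ℂ).conjTranspose * g)).trace ∧
      (a : ℂ) • ((h : Matrix (Fin 2) (Fin 2) ℂ).conjTranspose * h) +
        (b : ℂ) • (pauliBasis w * ((h : Matrix (Fin 2) (Fin 2) ℂ).conjTranspose * h) *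
          pauliBasis w) = (g : Matrix (Fin 2) (Fin 2) ℂ).conjTranspose * g := by
  have hGstar : ((g : Matrix (Fin 2) (Fin 2) ℂ).conjTranspose * g).conjTranspose =
      (g : Matrix (Fin 2) (Fin 2) ℂ).conjTranspose * g := by
    rw [Matrix.conjTranspose_mul, Matrix.conjTranspose_conjTranspose]
  have hG0 : 0 < (((g : Matrix (Fin 2) (Fin 2) ℂ).conjTranspose * g) 0 0).re := by
    have e : ((g : Matrix (Fin 2) (Fin 2) ℂ).conjTranspose * g) 0 0
        = ((Complex.normSq (g.1 0 0) + Complex.normSq (g.1 1 0) : ℝ) : ℂ) := by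
      simp only [Matrix.mul_apply, Fin.sum_univ_two, Matrix.conjTranspose_apply,
        Complex.ofReal_add, Complex.normSq_eq_conj_mul_self]
      rfl
    rw [e, Complex.ofReal_re]
    refine lt_of_le_of_ne (add_nonneg (Complex.normSq_nonneg _) (Complex.normSq_nonneg _))
      fun h => g.det_ne_zero ?_
    have h0 := (add_eq_zero_iff_of_nonneg (Complex.normSq_nonneg _)
      (Complex.normSq_nonneg _)).mp h.symm
    rw [Matrix.det_fin_two, Complex.normSq_eq_zero.mp h0.1, Complex.normSq_eq_zero.mp h0.2]
    ring
  have hGdet : 0 < ((g : Matrix (Fin 2) (Fin 2) ℂ).conjTranspose * g).det.re := by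
    rw [Matrix.det_mul, Matrix.det_conjTranspose, RCLike.star_def,
      ← Complex.normSq_eq_conj_mul_self, Complex.ofReal_re]
    exact Complex.normSq_pos.mpr g.det_ne_zero
  generalize (g : Matrix (Fin 2) (Fin 2) ℂ).conjTranspose * g = G at *
  obtain ⟨D, κ, hκ, hD0, hD, hDw, hGw⟩ := exists_anticommuting hw G hGstar
  have hev : ∀ᶠ τ : ℝ in nhdsWithin 0 (Set.Ioi 0), 0 < ((G + (τ : ℂ) • D) 0 0).re ∧
      0 < (G + (τ : ℂ) • D).det.re := by
    apply nhdsWithin_le_nhds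
    have c0 : Continuous fun τ : ℝ => ((G + (τ : ℂ) • D) 0 0).re := by
      simp only [Matrix.add_apply, Matrix.smul_apply, smul_eq_mul]
      fun_prop
    have c1 : Continuous fun τ : ℝ => (G + (τ : ℂ) • D).det.re := by
      simp only [Matrix.det_fin_two, Matrix.add_apply, Matrix.smul_apply, smul_eq_mul]
      fun_prop
    exact (c0.continuousAt.eventually (lt_mem_nhds (by simpa using hG0))).and
      (c1.continuousAt.eventually (lt_mem_nhds (by simpa using hGdet)))
  obtain ⟨τ, ⟨h0, hdet⟩, hτ⟩ := (hev.and self_mem_nhdsWithin).exists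
  replace hτ : 0 < τ := hτ
  obtain ⟨h, hh⟩ := exists_gram_eq (H := G + (τ : ℂ) • D)
    (by rw [Matrix.conjTranspose_add, Matrix.conjTranspose_smul, hGstar, hD]; simp) h0 hdet
  have hden : 0 < 2 * κ + 2 * τ := by positivity
  have hden' : (2 * κ + 2 * τ : ℂ) ≠ 0 := by exact_mod_cast hden.ne'
  have trD : D.trace = 0 := by
    have := trace_pauliBasis_mul_mul w D
    rw [hDw, Matrix.trace_neg] at this
    linear_combination (-1 / 2) * this
  have trGD : (G * D).trace = κ * (D * D).trace := by
    have := trace_pauliBasis_mul_mul w (G * D)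
    rw [← pauliBasis_mul_mul_mul_mul, hDw, hGw, Matrix.mul_neg, Matrix.sub_mul, Matrix.smul_mul,
      Matrix.trace_neg, Matrix.trace_sub, Matrix.trace_smul, smul_eq_mul] at this
    linear_combination (-1 / 2) * this
  have trDD : (D * D).trace ≠ 0 := by
    have : D.conjTranspose * D = D * D := by rw [hD]
    rw [← this]
    open scoped ComplexOrder in
    rw [Ne, Matrix.trace_conjTranspose_mul_self_eq_zero_iff]
    exact hD0
  refine ⟨h, (2 * κ + τ) / (2 * κ + 2 * τ), τ / (2 * κ + 2 * τ), by positivity, by positivity,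
    ?_, ?_, ?_⟩
  · rw [hh, Matrix.trace_add, Matrix.trace_smul, trD, smul_zero, add_zero]
  · rw [hh]
    intro heq
    have hexp : ((G + (τ : ℂ) • D) * (G + (τ : ℂ) • D)).trace =
        (G * G).trace + (2 * κ * τ + τ ^ 2) * (D * D).trace := by
      simp only [Matrix.add_mul, Matrix.mul_add, Matrix.smul_mul, Matrix.mul_smul,
        Matrix.trace_add, Matrix.trace_smul, smul_eq_mul, Matrix.trace_mul_comm D G, trGD]
      ring
    rw [hexp] at heq
    have hpos : 0 < 2 * κ * τ + τ ^ 2 := by positivity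
    have hne : (2 * κ * τ + τ ^ 2 : ℂ) ≠ 0 := by exact_mod_cast hpos.ne'
    exact mul_ne_zero hne trDD (by linear_combination heq)
  · rw [hh, Matrix.mul_add, Matrix.add_mul, Matrix.mul_smul, Matrix.smul_mul, hDw, hGw]
    have ha : (((2 * κ + τ) / (2 * κ + 2 * τ) : ℝ) : ℂ) + ((τ / (2 * κ + 2 * τ) : ℝ) : ℂ) = 1 := by
      push_cast
      rw [← add_div, div_eq_one_iff_eq hden']
      ring
    have hb : (((2 * κ + τ) / (2 * κ + 2 * τ) : ℝ) : ℂ) * τ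
        = ((τ / (2 * κ + 2 * τ) : ℝ) : ℂ) * (2 * κ + τ) := by
      push_cast
      field_simp
    linear_combination (norm := module) ha • G + hb • D

theorem exists_unitary_of_alongAxis {w : Fin 3} {A : Matrix (Fin 2) (Fin 2) ℂ}
    (h : AlongAxis w A) : ∃ V : Matrix (Fin 2) (Fin 2) ℂ, V.conjTranspose * V = 1 ∧
      V * A = A * pauliBasis w.succ := by
  obtain ⟨U, s, t, hU, rfl⟩ := h.exists_conjTranspose_mul_self
  have hUU : U.conjTranspose * U = 1 := Matrix.mem_unitaryGroup_iff'.mp hU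
  have hσ := pauliBasis_mul_self w.succ
  refine ⟨U * pauliBasis w.succ * U.conjTranspose, ?_, ?_⟩
  · rw [Matrix.conjTranspose_mul, Matrix.conjTranspose_mul, Matrix.conjTranspose_conjTranspose,
      pauliBasis_conjTranspose]
    calc _ = U * (pauliBasis w.succ * (U.conjTranspose * U) * pauliBasis w.succ) *
          U.conjTranspose := by simp only [Matrix.mul_assoc]
      _ = 1 := by
        rw [hUU, Matrix.mul_one, hσ, Matrix.mul_one]
        exact Matrix.mem_unitaryGroup_iff.mp hU
  · calc _ = U * pauliBasis w.succ * (U.conjTranspose * U) *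
          (s • 1 + t • pauliBasis w.succ) := by simp only [Matrix.mul_assoc]
      _ = _ := by
        rw [hUU, Matrix.mul_one, Matrix.mul_assoc, Matrix.mul_assoc]
        congr 1
        simp [Matrix.mul_add, Matrix.add_mul]

/-- If local unitaries U take one state to the other up to a factor, then h⁻¹Ug is a symmetry of the
seed, hence a Pauli product. -/
theorem gram_eq_of_luEquivalent {p : Fin 4 → ℂ} (hp : GenericSeed p) {g h : Fin 4 → GL (Fin 2) ℂ}
    (H : LUEquivalent (genericState p g) (genericState p h)) (k : Fin 4) :
    ∃ (v : Fin 4) (r : ℂ), (g k : Matrix (Fin 2) (Fin 2) ℂ).conjTranspose * g k =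
      r • (pauliBasis v * ((h k : Matrix (Fin 2) (Fin 2) ℂ).conjTranspose * h k) *
        pauliBasis v) := by
  obtain ⟨U, c, hc, hU⟩ := H
  have hS : localApply (d := fun _ => 2) (e := fun _ => 2)
      (fun i => (((h i)⁻¹ : GL (Fin 2) ℂ) : Matrix (Fin 2) (Fin 2) ℂ) *
        ((U i : Matrix (Fin 2) (Fin 2) ℂ) * g i)) (seed p) = c⁻¹ • seed p := by
    rw [← localApply_localApply (d := fun _ => 2) (e := fun _ => 2),
      ← localApply_localApply (d := fun _ => 2) (e := fun _ => 2), ← genericState,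
      ← inv_smul_smul₀ hc (localApply (d := fun _ => 2) (e := fun _ => 2) _ (genericState p g)),
      ← hU, localApply_smul_right, genericState,
      localApply_eq_of_left_inverse (d := fun _ => 2) (e := fun _ => 2)]
    intro i
    rw [← Units.val_mul, inv_mul_cancel, Units.val_one]
  obtain ⟨v, s, hs⟩ := hp.stabilizer (inv_ne_zero hc) hS
  have hk : (U k : Matrix (Fin 2) (Fin 2) ℂ) * g k = s k • (h k * pauliBasis v) := by
    rw [← Matrix.mul_smul, ← hs k, ← Matrix.mul_assoc, ← Units.val_mul, mul_inv_cancel,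
      Units.val_one, Matrix.one_mul]
  have hUU : (U k : Matrix (Fin 2) (Fin 2) ℂ).conjTranspose * U k = 1 :=
    Matrix.mem_unitaryGroup_iff'.mp (U k).2
  refine ⟨v, star (s k) * s k, ?_⟩
  calc _ = (g k : Matrix (Fin 2) (Fin 2) ℂ).conjTranspose *
        ((U k : Matrix (Fin 2) (Fin 2) ℂ).conjTranspose * U k) * g k := by
        rw [hUU, Matrix.mul_one]
    _ = ((U k : Matrix (Fin 2) (Fin 2) ℂ) * g k).conjTranspose *
        ((U k : Matrix (Fin 2) (Fin 2) ℂ) * g k) := by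
        rw [Matrix.conjTranspose_mul]; simp only [Matrix.mul_assoc]
    _ = _ := by
        rw [hk, Matrix.conjTranspose_smul, Matrix.conjTranspose_mul, pauliBasis_conjTranspose,
          Matrix.smul_mul, Matrix.mul_smul, smul_smul]
        simp only [Matrix.mul_assoc]

/-- States of the axis form can be converted by a two-outcome measurement of one party. -/
theorem exists_conversion_of_hasAxisForm {p : Fin 4 → ℂ} (hp : GenericSeed p)
    {g : Fin 4 → GL (Fin 2) ℂ} (hg : HasAxisForm g) :
    ∃ φ, FullyEntangled φ ∧ ¬ LUEquivalent (genericState p g) φ ∧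
      LOCCConvertible (genericState p g) φ := by
  obtain ⟨k, w, hkw⟩ := hg
  obtain ⟨h, a, b, ha, hb, htr, htr2, hmix⟩ := exists_gram_mixture (g k) (Fin.succ_ne_zero w)
  refine ⟨genericState p (Function.update g k h), genericState_fullyEntangled hp _, ?_, ?_⟩
  · intro hLU
    obtain ⟨v, r, hr⟩ := gram_eq_of_luEquivalent hp hLU k
    rw [Function.update_self] at hr
    have h1 := congrArg Matrix.trace hr
    rw [Matrix.trace_smul, trace_pauliBasis_mul_mul, htr, smul_eq_mul] at h1
    have hr1 : r = 1 := mul_right_cancel₀ (trace_gram_ne_zero (g k)) (by rw [← h1, one_mul])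
    rw [hr1, one_smul] at hr
    apply htr2
    rw [hr, pauliBasis_mul_mul_mul_mul, trace_pauliBasis_mul_mul]
  · have hV : ∀ i, ∃ V : Matrix (Fin 2) (Fin 2) ℂ, i ≠ k →
        V.conjTranspose * V = 1 ∧ V * g i = g i * pauliBasis w.succ := by
      intro i
      by_cases hi : i = k
      · exact ⟨1, fun h => absurd hi h⟩
      · obtain ⟨V, h1, h2⟩ := exists_unitary_of_alongAxis (hkw i hi)
        exact ⟨V, fun _ => ⟨h1, h2⟩⟩
    choose V hV using hV
    let σ : Fin 2 → Matrix (Fin 2) (Fin 2) ℂ := ![1, pauliBasis w.succ]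
    let r : Fin 2 → ℂ := ![(√a : ℝ), (√b : ℝ)]
    -- After outcome `j` every party's total operator is the target operator times `σ j`: party `k`
    -- includes it in its Kraus operator, the others apply `V i`.
    let K : Fin 2 → Fin 4 → Matrix (Fin 2) (Fin 2) ℂ := fun j i =>
      if i = k then r j • ((h : Matrix (Fin 2) (Fin 2) ℂ) * σ j * ((g k)⁻¹ : GL (Fin 2) ℂ))
      else if j = 0 then 1 else V i
    have hgg : (((g k)⁻¹ : GL (Fin 2) ℂ) : Matrix (Fin 2) (Fin 2) ℂ) * g k = 1 := by
      rw [← Units.val_mul, inv_mul_cancel, Units.val_one]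
    have hgg' : (g k : Matrix (Fin 2) (Fin 2) ℂ) * ((g k)⁻¹ : GL (Fin 2) ℂ) = 1 := by
      rw [← Units.val_mul, mul_inv_cancel, Units.val_one]
    refine LOCCTo.round (d := fun _ => 2) _ k 2 (fun _ _ => 2) K ?_ ?_ ?_
    · have hterm : ∀ j, (K j k).conjTranspose * K j k =
          (((g k)⁻¹ : GL (Fin 2) ℂ) : Matrix (Fin 2) (Fin 2) ℂ).conjTranspose *
            ((star (r j) * r j) • ((σ j).conjTranspose *
              ((h : Matrix (Fin 2) (Fin 2) ℂ).conjTranspose * h) * σ j)) *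
            ((g k)⁻¹ : GL (Fin 2) ℂ) := by
        intro j
        simp only [K, if_true, Matrix.conjTranspose_smul, Matrix.conjTranspose_mul,
          Matrix.smul_mul, Matrix.mul_smul, smul_smul, Matrix.mul_assoc]
        rw [mul_comm]
      rw [Finset.sum_congr rfl fun j _ => hterm j, ← Matrix.sum_mul, ← Matrix.mul_sum,
        Fin.sum_univ_two]
      have hra : star (r 0) * r 0 = a := by
        simp [r, ← Complex.ofReal_mul, Real.mul_self_sqrt ha]
      have hrb : star (r 1) * r 1 = b := by
        simp [r, ← Complex.ofReal_mul, Real.mul_self_sqrt hb]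
      have hσ0 : σ 0 = 1 := rfl
      have hσ1 : σ 1 = pauliBasis w.succ := rfl
      rw [hra, hrb, hσ0, hσ1, Matrix.conjTranspose_one, Matrix.one_mul, Matrix.mul_one,
        pauliBasis_conjTranspose, hmix]
      calc _ = ((g k : Matrix (Fin 2) (Fin 2) ℂ) * ((g k)⁻¹ : GL (Fin 2) ℂ)).conjTranspose *
            ((g k : Matrix (Fin 2) (Fin 2) ℂ) * ((g k)⁻¹ : GL (Fin 2) ℂ)) := by
            rw [Matrix.conjTranspose_mul]; simp only [Matrix.mul_assoc]
        _ = 1 := by rw [hgg', Matrix.conjTranspose_one, Matrix.one_mul]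
    · intro j i hi
      simp only [K, if_neg hi]
      split_ifs
      · rw [Matrix.conjTranspose_one, Matrix.one_mul]
      · exact (hV i hi).1
    · intro j
      refine LOCCTo.done (r j) _ ?_
      rw [genericState, localApply_localApply]
      have hfac : ∀ i, K j i * (g i : Matrix (Fin 2) (Fin 2) ℂ) =
          (if i = k then r j else 1) •
            (((Function.update g k h i : GL (Fin 2) ℂ) : Matrix (Fin 2) (Fin 2) ℂ) * σ j) := by
        intro i
        by_cases hi : i = k
        · subst hi
          simp only [K, if_true, Function.update_self, Matrix.smul_mul]
          rw [Matrix.mul_assoc, hgg, Matrix.mul_one]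
        · simp only [K, if_neg hi, Function.update_of_ne hi, one_smul]
          fin_cases j
          · simp [σ]
          · simpa [σ] using (hV i hi).2
      simp only [hfac]
      rw [localApply_smul, Fintype.prod_ite_eq', ← localApply_localApply (d := fun _ => 2)
        (e := fun _ => 2) (f := fun _ => 2), genericState]
      have hσ : localApply (d := fun _ => 2) (e := fun _ => 2) (fun _ => σ j) (seed p) = seed p := by
        fin_cases j
        · exact localApply_one (d := fun _ => 2) _
        · exact localApply_pauliBasis_seed p w.succ
      rw [hσ]

end AxisConversion

/-! ### States of the axis form have measure zero. -/

section NullSet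

/-- The columns are eigenvectors of the Pauli matrix `w`. -/
noncomputable def axisFrame : Fin 3 → Matrix (Fin 2) (Fin 2) ℂ :=
  ![!![1, 1; 1, -1], !![1, 1; Complex.I, -Complex.I], 1]

theorem axisFrame_det_ne_zero (w : Fin 3) : (axisFrame w).det ≠ 0 := by
  fin_cases w
  · simp [axisFrame, Matrix.det_fin_two]; norm_num
  · have : -Complex.I - Complex.I = -2 * Complex.I := by ring
    simp [axisFrame, Matrix.det_fin_two, this]
  · simp [axisFrame]

/-- Up to a factor, every invertible operator along the axis `w` has this form. -/
noncomputable def axisParam (w : Fin 3) (t : ℝ × ℂ × ℂ) : Matrix (Fin 2) (Fin 2) ℂ :=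
  !![(t.1 : ℂ), -(t.2.2 * starRingEnd ℂ t.2.1); t.2.1, t.2.2 * t.1] * (axisFrame w)⁻¹

/-- The columns of `axisFrame w` are orthogonal eigenvectors of σ, so those of `A * axisFrame w` are
orthogonal too. A scalar makes the top left entry real, and the second column is then a multiple of
(-z̄, x) for the first column (x, z): five real parameters. -/
theorem AlongAxis.exists_axisParam {w : Fin 3} {A : Matrix (Fin 2) (Fin 2) ℂ} (hA : A.det ≠ 0)
    (h : AlongAxis w A) : ∃ (c : ℂ) (t : ℝ × ℂ × ℂ), A = c • axisParam w t := by
  obtain ⟨U, s, t, hU, hAU⟩ := h.exists_conjTranspose_mul_self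
  have hframe : IsUnit (axisFrame w).det := isUnit_iff_ne_zero.mpr (axisFrame_det_ne_zero w)
  set M := A * axisFrame w with hM
  have hMdet : M.det ≠ 0 := by
    rw [hM, Matrix.det_mul]; exact mul_ne_zero hA (axisFrame_det_ne_zero w)
  have hAM : A = M * (axisFrame w)⁻¹ := by
    rw [hM, Matrix.mul_nonsing_inv_cancel_right _ _ hframe]
  have horth : starRingEnd ℂ (M 0 0) * M 0 1 + starRingEnd ℂ (M 1 0) * M 1 1 = 0 := by
    have h1 : M.conjTranspose * M =
        ((s • 1 + t • pauliBasis w.succ) * axisFrame w).conjTranspose *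
          ((s • 1 + t • pauliBasis w.succ) * axisFrame w) := by
      have hUU : U.conjTranspose * U = 1 := Matrix.mem_unitaryGroup_iff'.mp hU
      calc _ = ((s • 1 + t • pauliBasis w.succ) * axisFrame w).conjTranspose *
            (U.conjTranspose * U) * ((s • 1 + t • pauliBasis w.succ) * axisFrame w) := by
            rw [hM, hAU, Matrix.mul_assoc U, Matrix.conjTranspose_mul U]
            simp only [Matrix.mul_assoc]
        _ = _ := by rw [hUU, Matrix.mul_one]
    have h2 := congrFun (congrFun h1 0) 1
    have h3 : (M.conjTranspose * M) 0 1 =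
        starRingEnd ℂ (M 0 0) * M 0 1 + starRingEnd ℂ (M 1 0) * M 1 1 := by
      simp [Matrix.mul_apply, Fin.sum_univ_two, Matrix.conjTranspose_apply]
    rw [← h3, h2]
    fin_cases w <;> simp [axisFrame, pauliBasis, Matrix.mul_apply, Fin.sum_univ_two,
      Matrix.conjTranspose_apply]
    · ring
    · have hI := Complex.I_sq
      grind
  rw [Matrix.det_fin_two] at hMdet
  have hext : ∀ N : Matrix (Fin 2) (Fin 2) ℂ, M 0 0 = N 0 0 → M 0 1 = N 0 1 → M 1 0 = N 1 0 →
      M 1 1 = N 1 1 → M = N := by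
    intro N a b c d
    ext i j
    fin_cases i <;> fin_cases j
    exacts [a, b, c, d]
  by_cases h0 : M 0 0 = 0
  · have h10 : M 1 0 ≠ 0 := by
      intro h
      apply hMdet
      rw [h0, h]; ring
    have h10' : starRingEnd ℂ (M 1 0) ≠ 0 := (map_ne_zero _).mpr h10
    have h11 : M 1 1 = 0 := by
      rw [h0, map_zero, zero_mul, zero_add] at horth
      exact (mul_eq_zero.mp horth).resolve_left h10'
    -- A vanishing top left entry is already real, so no rescaling is needed.
    refine ⟨1, (0, M 1 0, -(M 0 1 / starRingEnd ℂ (M 1 0))), ?_⟩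
    rw [one_smul, axisParam, hAM]
    congr 1
    apply hext <;> simp [h0, h11]
    field_simp
  · have h0' : starRingEnd ℂ (M 0 0) ≠ 0 := (map_ne_zero _).mpr h0
    refine ⟨M 0 0, (1, M 1 0 / M 0 0, M 1 1 / M 0 0), ?_⟩
    rw [axisParam, hAM, ← Matrix.smul_mul]
    congr 1
    apply hext <;> simp
    · field_simp
      linear_combination horth
    · field_simp
    · field_simp

/-- A parametrisation of the generic states of the axis form in which party `k` holds the
arbitrary operator. -/
noncomputable def axisState (k : Fin 4) (w : Fin 3)
    (x : (Fin 4 → ℂ) × (Fin 2 → Fin 2 → ℂ) × (Fin 3 → ℝ × ℂ × ℂ)) : FourQubit :=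
  localApply (d := fun _ => 2) (e := fun _ => 2)
    (Fin.insertNth (α := fun _ => Matrix (Fin 2) (Fin 2) ℂ) k (Matrix.of x.2.1)
      fun j => axisParam w (x.2.2 j)) (seed x.1)

theorem contDiff_axisParam (w : Fin 3) (i j : Fin 2) :
    ContDiff ℝ 1 fun t => axisParam w t i j := by
  have hc : ContDiff ℝ 1 fun t : ℝ × ℂ × ℂ => (t.1 : ℂ) :=
    Complex.ofRealCLM.contDiff.comp contDiff_fst
  have hs : ContDiff ℝ 1 fun t : ℝ × ℂ × ℂ => starRingEnd ℂ t.2.1 :=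
    Complex.conjCLE.contDiff.comp (contDiff_fst.comp contDiff_snd)
  simp only [axisParam, Matrix.mul_apply, Fin.sum_univ_two]
  fin_cases i <;> simp <;> fun_prop

theorem contDiff_seed (y : Fin 4 → Fin 2) : ContDiff ℝ 1 fun p => seed p y := by
  unfold seed
  split_ifs <;> fun_prop

theorem contDiff_axisState (k : Fin 4) (w : Fin 3) : ContDiff ℝ 1 (axisState k w) := by
  refine contDiff_pi.mpr fun z => ?_
  unfold axisState localApply
  refine ContDiff.sum fun y _ => ContDiff.mul (contDiff_prod fun i _ => ?_)
    ((contDiff_seed y).comp contDiff_fst)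
  rcases Fin.eq_self_or_eq_succAbove k i with rfl | ⟨j, rfl⟩
  · simp only [Fin.insertNth_apply_same, Matrix.of_apply]
    fun_prop
  · simp only [Fin.insertNth_apply_succAbove]
    exact (contDiff_axisParam w _ _).comp (by fun_prop)

/-- A C¹ image of a 31-dimensional real space has Hausdorff dimension at most 31, hence
32-dimensional Hausdorff measure zero, and on the target that measure is a Haar measure. -/
theorem volume_range_axisState (k : Fin 4) (w : Fin 3) :
    volume (Set.range (axisState k w)) = 0 := by
  have h1 : Module.finrank ℝ ((Fin 4 → ℂ) × (Fin 2 → Fin 2 → ℂ) × (Fin 3 → ℝ × ℂ × ℂ)) = 31 := by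
    simp [Module.finrank_prod, Module.finrank_pi_fintype]
  have h2 : Module.finrank ℝ FourQubit = 32 := by
    simp [Module.finrank_pi_fintype]
  have hdim := (contDiff_axisState k w).dimH_range_le
  rw [h1] at hdim
  have hlt : dimH (Set.range (axisState k w)) < ((32 : NNReal) : ENNReal) :=
    lt_of_le_of_lt hdim (by norm_num)
  have hzero := hausdorffMeasure_of_dimH_lt hlt
  have hHaar := isAddHaarMeasure_hausdorffMeasure (E := FourQubit)
  rw [h2] at hHaar
  have hac := Measure.absolutelyContinuous_isAddHaarMeasure (volume : Measure FourQubit)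
    (Measure.hausdorffMeasure ((32 : ℕ) : ℝ))
  exact hac (by exact_mod_cast hzero)

theorem seed_smul (c : ℂ) (p : Fin 4 → ℂ) : seed (c • p) = c • seed p := by
  ext x
  simp only [seed, Pi.smul_apply, smul_eq_mul]
  split_ifs <;> ring

theorem genericState_mem_range_axisState (p : Fin 4 → ℂ) {g : Fin 4 → GL (Fin 2) ℂ}
    (hg : HasAxisForm g) : ∃ k w, genericState p g ∈ Set.range (axisState k w) := by
  obtain ⟨k, w, hkw⟩ := hg
  have hex : ∀ j : Fin 3, ∃ (c : ℂ) (t : ℝ × ℂ × ℂ),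
      (g (k.succAbove j) : Matrix (Fin 2) (Fin 2) ℂ) = c • axisParam w t := fun j =>
    (hkw _ (Fin.succAbove_ne k j)).exists_axisParam (g _).det_ne_zero
  choose c t hct using hex
  -- The scalars of the three parametrised operators move into the seed, which is linear in its
  -- parameters; keeping them would exceed dimension 31.
  refine ⟨k, w, ((∏ j, c j) • p, (g k).1, t), ?_⟩
  have hgeq : (fun i => (g i : Matrix (Fin 2) (Fin 2) ℂ)) = fun i =>
      (Fin.insertNth (α := fun _ => ℂ) k 1 c i) •
        (Fin.insertNth (α := fun _ => Matrix (Fin 2) (Fin 2) ℂ) k (Matrix.of (g k).1)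
          (fun j => axisParam w (t j)) i) := by
    funext i
    rcases Fin.eq_self_or_eq_succAbove k i with rfl | ⟨j, rfl⟩
    · simp only [Fin.insertNth_apply_same, one_smul]
      rfl
    · simp only [Fin.insertNth_apply_succAbove, hct]
  rw [genericState, hgeq, localApply_smul, Fin.prod_univ_succAbove _ k]
  simp only [Fin.insertNth_apply_same, Fin.insertNth_apply_succAbove, one_mul]
  rw [axisState, seed_smul, localApply_smul_right]

/-- Quantifying over all `p` and `g` covers every representation of the state, whichever one
witnesses that it is generic. -/
theorem ae_not_hasAxisForm : ∀ᵐ ψ : FourQubit, ∀ p g, ψ = genericState p g → ¬ HasAxisForm g := by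
  have hnull : volume (⋃ (k : Fin 4) (w : Fin 3), Set.range (axisState k w)) = 0 := by
    simp only [measure_iUnion_null_iff]
    exact fun k w => volume_range_axisState k w
  refine measure_mono_null (fun ψ hψ => ?_) hnull
  simp only [Set.mem_compl_iff, Set.mem_ofPred_eq] at hψ
  push Not at hψ
  obtain ⟨p, g, rfl, hg⟩ := hψ
  simpa only [Set.mem_iUnion] using genericState_mem_range_axisState p hg

end NullSet

/-! ### Isolation and the three claims. -/

theorem isolated_of_not_hasAxisForm {p : Fin 4 → ℂ} (hp : GenericSeed p)
    {g : Fin 4 → GL (Fin 2) ℂ} (hg : ¬ HasAxisForm g) : Isolated (genericState p g) := by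
  refine fun φ hφ hLU => ⟨fun hconv => ?_, fun hconv => ?_⟩
  · obtain ⟨h, rfl⟩ := exists_genericState_of_convertible_to hp g hφ hconv
    rcases hconv.luEquivalent_or_hasAxisForm hp with H | H
    exacts [hLU H.2, hg H.2]
  · obtain ⟨h, rfl⟩ := exists_genericState_of_convertible_from hp g hφ hconv
    rcases hconv.luEquivalent_or_hasAxisForm hp with H | H
    exacts [hLU H.1, hg H.1]

theorem theorem3 :
    (∀ (p : Fin 4 → ℂ) (g : Fin 4 → GL (Fin 2) ℂ), GenericSeed p →
      ((∃ φ : FourQubit, FullyEntangled φ ∧ ¬ LUEquivalent (genericState p g) φ ∧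
          LOCCConvertible (genericState p g) φ) ↔ HasAxisForm g)) ∧
    (∀ (p : Fin 4 → ℂ) (g : Fin 4 → GL (Fin 2) ℂ), GenericSeed p →
      ¬ HasAxisForm g → Isolated (genericState p g)) ∧
    (∀ᵐ ψ : FourQubit, IsGeneric ψ → Isolated ψ) := by
  refine ⟨fun p g hp => ⟨?_, exists_conversion_of_hasAxisForm hp⟩,
    fun p g hp hg => isolated_of_not_hasAxisForm hp hg, ?_⟩
  · rintro ⟨φ, hφ, hLU, hconv⟩
    by_contra hg
    exact (isolated_of_not_hasAxisForm hp hg φ hφ hLU).2 hconv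
  · filter_upwards [ae_not_hasAxisForm] with ψ hψ
    rintro ⟨p, g, hp, rfl⟩
    exact isolated_of_not_hasAxisForm hp (hψ p g rfl)
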